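/- **Setting.** Let $1 \le n < d$, let $X_1,\dots,X_n$ be iid random covariates in $\mathbb{R}^p$, let $\mathbf a:\mathbb{R}^p\to\mathbb{R}^d$ be a measurable feature map, let $\mathbf A\in\mathbb{R}^{n\times d}$ be the matrix with rows $\mathbf a(X_i)^\top$, and let $\mathbf W\in\mathbb{R}^n$ have iid $\mathcal N(0,\sigma^2)$ entries ($\sigma>0$), independent of the $X_i$. An instance of the $(k,\sigma^2)$-sparse linear model is a vector $\alpha^*\in\mathbb{R}^d$ with at most $k$ nonzero entries; its training output is $\mathbf Y=\mathbf A\alpha^*+\mathbf W$. The test MSE of $\alpha\in\mathbb{R}^d$ is $\mathcal E_{\rm test}(\alpha)=\mathbb E[(\langle \mathbf a(X),\alpha^*\rangle+W-\langle\mathbf a(X),\alpha\rangle)^2]-\sigma^2$, the expectation being over a fresh covariate $X$ and fresh independent noise $W\sim\mathcal N(0,\sigma^2)$ only. For $\beta\in(0,1]$ and a fixed matrix $\mathbf A$, a map $\hat\alpha:\mathbb{R}^n\to\mathbb{R}^d$ is a *$\beta$-parsimonious interpolating operator* if for every $\mathbf Y\in\mathbb{R}^n$ one has $\mathbf A\hat\alpha(\mathbf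 Y)=\mathbf Y$ and $\|\mathbf A\,\hat\alpha_{\rm trunc}\|_2^2\ge\beta\|\mathbf Y\|_2^2$, where $\hat\alpha_{\rm trunc}$ keeps the $n$ coefficients of $\hat\alpha(\mathbf Y)$ that are largest in absolute value and sets the others to $0$ (ties may be broken in any way). A random vector $\mathbf b\in\mathbb{R}^d$ is *sub-Gaussian with parameter at most $K$* if $q^{-1/2}\,\mathbb E\big[|\langle \mathbf b,v\rangle|^q\big]^{1/q}\le K\|v\|_2$ for all $v\in\mathbb{R}^d$ and all real $q\ge1$. **Theorem.** Let $\beta\in(0,1]$ and let $\hat\alpha=\hat\alpha(\mathbf A,\mathbf Y)$ be an estimator such that $\hat\alpha(\mathbf A,\cdot)$ is a $\beta$-parsimonious interpolating operator for almost every realization of $\mathbf A$. 1. (Gaussian features.) Suppose that the entries of $\mathbf A$ are iid $\mathcal N(0,1)$. Then for every $k\ge0$ there is an instance of the $(k,\sigma^2)$-sparse linear model such that for every $\delta>0$ $$\mathcal E_{\rm test}(\hat\alpha)\ \ge\ \frac{\beta\sigma^2(1-\delta)}{16\ln(d/n)}$$ with probability at least $1-e^{-n\ln(d/n)}-e^{-n\delta^2/2}$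 over $(\mathbf A,\mathbf W)$. Moreover there is an absolute constant $\gamma_0>1$ such that, whenever $d\ge\gamma_0 n$, the same holds with $\dfrac{\beta\sigma^2(1-\delta)}{4\ln(d/n)}$ on the right-hand side. 2. (Sub-Gaussian rows.) For every $K>0$ there is a constant $C''_K>0$ depending only on $K$ such that, if $\mathbb E[\mathbf a(X)\mathbf a(X)^\top]=\mathbf I_d$ and $\mathbf a(X)$ is sub-Gaussian with parameter at most $K$, then for every $k\ge0$ there is an instance of the $(k,\sigma^2)$-sparse linear model such that for every $\delta>0$ $$\mathcal E_{\rm test}(\hat\alpha)\ \ge\ \frac{\beta\sigma^2(1-\delta)}{C''_K\ln(d/n)}$$ with probability at least $1-e^{-n\ln(d/n)}-e^{-n\delta^2/2}$ over $(\mathbf A,\mathbf W)$. (Since $k=0$ is allowed, the instance can be taken to have zero signal, $\alpha^*=0$.) -/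

import Mathlib

open MeasureTheory ProbabilityTheory

noncomputable section

/-- The squared Euclidean norm of a real coordinate vector. -/
def sqNorm {m : ℕ} (v : Fin m → ℝ) : ℝ := ∑ i, v i ^ 2

/-! ### Parsimonious interpolating operators -/

/-- `S` is a set of indices of the `n` largest absolute values of coefficients of `α`
(with ties broken arbitrarily). -/
def IsTopSet {d : ℕ} (n : ℕ) (α : Fin d → ℝ) (S : Finset (Fin d)) : Prop :=
  S.card = n ∧ ∀ i ∈ S, ∀ j ∉ S, |α j| ≤ |α i|

/-- The vector `α` with all coefficients outside `S` set to `0`. -/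
def truncTo {d : ℕ} (S : Finset (Fin d)) (α : Fin d → ℝ) : Fin d → ℝ :=
  fun j => if j ∈ S then α j else 0

/-- For the fixed data matrix `A`, the map `f` (output vector to coefficient vector) is a
`β`-parsimonious interpolating operator. If several sets of `n` largest coefficients exist,
it is enough that one of them captures the energy. -/
def IsParsimonious {n d : ℕ} (β : ℝ) (A : Matrix (Fin n) (Fin d) ℝ)
    (f : (Fin n → ℝ) → (Fin d → ℝ)) : Prop :=
  ∀ Y : Fin n → ℝ, A.mulVec (f Y) = Y ∧
    ∃ S : Finset (Fin d), IsTopSet n (f Y) S ∧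
      β * sqNorm Y ≤ sqNorm (A.mulVec (truncTo S (f Y)))

/-! ### The linear model with random features -/

/-- The law `N(0, σ²)` of the noise. -/
def noiseLaw (σ : ℝ) : Measure ℝ := gaussianReal 0 (Real.toNNReal (σ ^ 2))

/-- The joint law of the `n` iid training covariates (with common law `P`) and of the `n` iid
noise variables, which are independent of the covariates. -/
def trainLaw {p : ℕ} (P : Measure (Fin p → ℝ)) (σ : ℝ) (n : ℕ) :
    Measure ((Fin n → (Fin p → ℝ)) × (Fin n → ℝ)) :=
  (Measure.pi fun _ : Fin n => P).prod (Measure.pi fun _ : Fin n => noiseLaw σ)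

/-- The training data matrix: its `i`-th row is the feature vector of the `i`-th covariate. -/
def dataMatrix {p n d : ℕ} (a : (Fin p → ℝ) → (Fin d → ℝ)) (X : Fin n → (Fin p → ℝ)) :
    Matrix (Fin n) (Fin d) ℝ :=
  Matrix.of fun i j => a (X i) j

/-- The training output `Y = A α* + W`. -/
def trainOutput {p n d : ℕ} (a : (Fin p → ℝ) → (Fin d → ℝ)) (αstar : Fin d → ℝ)
    (ω : (Fin n → (Fin p → ℝ)) × (Fin n → ℝ)) : Fin n → ℝ :=
  (dataMatrix a ω.1).mulVec αstar + ω.2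

/-- The test mean squared error of the coefficient vector `α`, minus the irreducible noise error:
the expectation is over a fresh covariate `q.1` and a fresh noise variable `q.2`. -/
def testMSE {p d : ℕ} (P : Measure (Fin p → ℝ)) (a : (Fin p → ℝ) → (Fin d → ℝ))
    (αstar : Fin d → ℝ) (σ : ℝ) (α : Fin d → ℝ) : ℝ :=
  (∫ q, ((a q.1 ⬝ᵥ αstar + q.2) - a q.1 ⬝ᵥ α) ^ 2 ∂(P.prod (noiseLaw σ))) - σ ^ 2

/-- `α` has at most `k` nonzero coefficients. -/
def IsSparse {d : ℕ} (k : ℕ) (α : Fin d → ℝ) : Prop :=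
  (Finset.univ.filter fun j => α j ≠ 0).card ≤ k

/-! ### Assumptions on the features -/

/-- The features are whitened: `E[a(X) a(X)ᵀ] = I`. -/
def IsWhitened {p d : ℕ} (P : Measure (Fin p → ℝ)) (a : (Fin p → ℝ) → (Fin d → ℝ)) : Prop :=
  ∀ j l : Fin d, Integrable (fun x => a x j * a x l) P ∧
    ∫ x, a x j * a x l ∂P = if j = l then 1 else 0

/-- The entries of the feature vector are iid standard Gaussian (so that, the rows being iid,
all entries of the data matrix are iid standard Gaussian). -/
def IsGaussianFeature {p d : ℕ} (P : Measure (Fin p → ℝ)) (a : (Fin p → ℝ) → (Fin d → ℝ)) :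
    Prop :=
  P.map a = Measure.pi fun _ : Fin d => gaussianReal 0 1

/-- A real random variable is sub-Gaussian with parameter at most `K`:
`q^(-1/2) (E|Z|^q)^(1/q) ≤ K` for every real `q ≥ 1`. -/
def IsSubGaussianVar {p : ℕ} (P : Measure (Fin p → ℝ)) (Z : (Fin p → ℝ) → ℝ) (K : ℝ) : Prop :=
  ∀ q : ℝ, 1 ≤ q → eLpNorm Z (ENNReal.ofReal q) P ≤ ENNReal.ofReal (K * √q)

/-- The random feature vector is sub-Gaussian with parameter at most `K`: every normalized
one-dimensional marginal is. -/
def IsSubGaussianFeature {p d : ℕ} (P : Measure (Fin p → ℝ)) (a : (Fin p → ℝ) → (Fin d → ℝ))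
    (K : ℝ) : Prop :=
  ∀ v : Fin d → ℝ, v ≠ 0 → IsSubGaussianVar P (fun x => (a x ⬝ᵥ v) / √(sqNorm v)) K

/-! ### The conclusion -/

/-- The estimator `alg` (a function of data matrix and output) fits noise harmfully with constant
`C`: for every `k` there is an instance `αstar` of the `(k, σ²)`-sparse linear model such that for
every `δ > 0` the test error of the estimator is at least `β σ² (1 - δ) / (C ln (d/n))` outside
an event of probability at most `exp (-n ln (d/n)) + exp (-n δ² / 2)`.
(No measurability of `alg` is required: the outer measure of the bad event is bounded.) -/
def FitsNoiseHarmfully {p n d : ℕ} (P : Measure (Fin p → ℝ)) (a : (Fin p → ℝ) → (Fin d → ℝ))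
    (σ β C : ℝ) (alg : Matrix (Fin n) (Fin d) ℝ → (Fin n → ℝ) → (Fin d → ℝ)) : Prop :=
  ∀ k : ℕ, ∃ αstar : Fin d → ℝ, IsSparse k αstar ∧
    ∀ δ : ℝ, 0 < δ →
      trainLaw P σ n
          {ω | ¬ (β * σ ^ 2 * (1 - δ) / (C * Real.log ((d : ℝ) / n)) ≤
            testMSE P a αstar σ (alg (dataMatrix a ω.1) (trainOutput a αstar ω)))} ≤
        ENNReal.ofReal
          (Real.exp (-(n * Real.log ((d : ℝ) / n))) + Real.exp (-(n * δ ^ 2 / 2)))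

end

/-! ### Determinant inequalities -/

/-! Take zero signal, for every `k`. The output is then pure noise, and whitening makes the test
error equal to `‖α‖²`, so the claim becomes a lower bound on the norm of any interpolant of the
noise. After division by `σ` the data are a matrix `A` with iid rows and an independent standard
Gaussian `w`. Write `L = log (d / n)` and `G = A Aᵀ`. Two mechanisms cover the range of `d / n`.

For large `d / n` parsimony is used. If `‖α‖²` were too small, the rescaled truncation would be an
`n`-sparse vector of norm at most one whose image has squared norm at least `C L ‖w‖² / (1 - δ)`. A
union bound over about `(e d / n) ^ n` supports, with averaging of an exponential over a unit ball
in place of a net, excludes this (`exp_norm_sq_le_lintegral_ball`, `measure_exists_sparse_le`). The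
Chernoff bound is applied jointly in `A` and `w`, so that a single exponent yields exactly `exp (-n
δ² / 2)`.

For small `d / n` interpolation alone suffices: `‖α‖² ≥ wᵀ G⁻¹ w`, and this form must be bounded
below even when `d - n` is tiny. For Gaussian features, rotation invariance replaces `w` by a
multiple of a basis vector, and a diagonal entry of `G⁻¹` is controlled by the residual of one row
in dimension `d - n + 1` (`gaussian_measure_quadForm_le`).

For sub-Gaussian rows, integrating out `w` in the Laplace transform gives `√(det G / det (G + λ
I))`. Concavity of log-determinant bounds this by an average over disjoint blocks `J` of `√(det G /
det (G + N λ P_J))`, with `N` the number of blocks and `P_J` the coordinate projection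
(`sqrt_inv_det_le_sum_blocks`). Each ratio is controlled by the residuals of the rows in `J` against
the remaining rows (`gram_det_le`). Given those remaining rows the residuals are independent, and
each is a quadratic form on a space of dimension `d - n + |J|`. Blocks of size `d - n` balance the
two contributions and give `exp (-n L)` (`measure_quadForm_le_of_hasExpSqMoments`). -/

theorem det_le_exp_trace_sub_card {ι : Type*} [Fintype ι] [DecidableEq ι] {Q : Matrix ι ι ℝ}
    (hQ : Q.PosSemidef) : Q.det ≤ Real.exp (Q.trace - Fintype.card ι) := by
  have h1 := hQ.1.det_eq_prod_eigenvalues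
  have h2 := hQ.1.trace_eq_sum_eigenvalues
  simp only [RCLike.ofReal_real_eq_id, id] at h1 h2
  rw [h1, h2]
  have : (∑ i, hQ.1.eigenvalues i) - Fintype.card ι = ∑ i, (hQ.1.eigenvalues i - 1) := by
    simp
  rw [this, Real.exp_sum]
  refine Finset.prod_le_prod (fun i _ => hQ.eigenvalues_nonneg i) fun i _ => ?_
  have := Real.add_one_le_exp (hQ.1.eigenvalues i - 1)
  linarith

/-- Tangent-line inequality for the concave function log-determinant at `T`. Factoring `S = Bᴴ B`
turns the ratio of determinants into the determinant of the positive semidefinite matrix `B T⁻¹ Bᴴ`,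
where `x ≤ exp (x - 1)` applies to each eigenvalue. -/
theorem det_le_det_mul_exp {ι : Type*} [Fintype ι] [DecidableEq ι] {S T : Matrix ι ι ℝ}
    (hS : S.PosSemidef) (hT : T.PosDef) :
    S.det ≤ T.det * Real.exp ((T⁻¹ * S).trace - Fintype.card ι) := by
  open scoped MatrixOrder in
  obtain ⟨B, rfl⟩ := CStarAlgebra.nonneg_iff_eq_star_mul_self.1 (Matrix.nonneg_iff_posSemidef.2 hS)
  rw [Matrix.star_eq_conjTranspose]
  have hQ : (B * T⁻¹ * B.conjTranspose).PosSemidef :=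
    hT.inv.posSemidef.mul_mul_conjTranspose_same B
  have h := det_le_exp_trace_sub_card hQ
  have htr : (T⁻¹ * (B.conjTranspose * B)).trace = (B * T⁻¹ * B.conjTranspose).trace := by
    rw [← Matrix.mul_assoc, Matrix.trace_mul_comm, Matrix.mul_assoc]
  have hdet : (B.conjTranspose * B).det = T.det * (B * T⁻¹ * B.conjTranspose).det := by
    have : T.det * T⁻¹.det = 1 := by
      rw [← Matrix.det_mul, Matrix.mul_nonsing_inv _ hT.det_pos.ne'.isUnit, Matrix.det_one]
    simp only [Matrix.det_mul]
    linear_combination (-(B.conjTranspose.det * B.det)) * this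
  rw [htr, hdet]
  exact mul_le_mul_of_nonneg_left h hT.det_pos.le

/-- The diagonal projection onto the coordinates in `J`. -/
noncomputable def coordProj {ι : Type*} [DecidableEq ι] (J : Finset ι) : Matrix ι ι ℝ :=
  Matrix.diagonal fun i => if i ∈ J then 1 else 0

theorem coordProj_posSemidef {ι : Type*} [Fintype ι] [DecidableEq ι] (J : Finset ι) :
    (coordProj J).PosSemidef :=
  Matrix.PosSemidef.diagonal fun i => by dsimp; split_ifs <;> simp

/-- A form of the concavity of the logarithm of the determinant. -/
theorem sqrt_inv_det_le_sum_blocks {ι κ : Type*} [Fintype ι] [DecidableEq ι] [Fintype κ]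
    {G : Matrix ι ι ℝ} (hG : G.PosDef) {lam : ℝ} (hlam : 0 < lam) (J : κ → Finset ι)
    (hJ : Pairwise (Function.onFun Disjoint J)) :
    Fintype.card κ * √((G + lam • (1 : Matrix ι ι ℝ)).det)⁻¹ ≤
      ∑ k, √((G + (Fintype.card κ * lam) • coordProj (J k)).det)⁻¹ := by
  classical
  set N : ℝ := (Fintype.card κ : ℝ) with hN
  have hN0 : 0 ≤ N := Nat.cast_nonneg _
  set T := G + lam • (1 : Matrix ι ι ℝ) with hTdef
  have hT : T.PosDef := hG.add (Matrix.PosDef.one.smul hlam)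
  have hS : ∀ k, (G + (N * lam) • coordProj (J k)).PosDef := fun k =>
    hG.add_posSemidef ((coordProj_posSemidef _).smul (mul_nonneg hN0 hlam.le))
  set x : κ → ℝ := fun k =>
    (T⁻¹ * (G + (N * lam) • coordProj (J k))).trace - Fintype.card ι with hx
  -- The tangent inequality at `T`, followed by `exp (-x / 2) ≥ 1 - x / 2`; the linear terms then
  -- cancel favourably in the sum over blocks.
  have key : ∀ k, √(T.det)⁻¹ * (1 - x k / 2) ≤ √((G + (N * lam) • coordProj (J k)).det)⁻¹ := by
    intro k
    have h := det_le_det_mul_exp (hS k).posSemidef hT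
    have hpos := (hS k).det_pos
    have h2 : √(T.det)⁻¹ * Real.exp (-(x k) / 2) ≤
        √((G + (N * lam) • coordProj (J k)).det)⁻¹ := by
      apply Real.le_sqrt_of_sq_le
      rw [mul_pow, Real.sq_sqrt (inv_nonneg.2 hT.det_pos.le), ← Real.exp_nat_mul]
      have : ((2 : ℕ) : ℝ) * (-(x k) / 2) = -(x k) := by push_cast; ring
      rw [this, Real.exp_neg, ← mul_inv]
      exact inv_anti₀ hpos h
    refine le_trans (mul_le_mul_of_nonneg_left ?_ (Real.sqrt_nonneg _)) h2
    have := Real.add_one_le_exp (-(x k) / 2)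
    linarith
  have hsum : ∑ k, x k ≤ 0 := by
    have hTT : (T⁻¹ * T).trace = Fintype.card ι := by
      rw [Matrix.nonsing_inv_mul _ hT.det_pos.ne'.isUnit, Matrix.trace_one]
    have e1 : ∀ k, x k = (N * lam) * (T⁻¹ * coordProj (J k)).trace - lam * T⁻¹.trace := by
      intro k
      have : T⁻¹ * (G + (N * lam) • coordProj (J k)) =
          T⁻¹ * T + (N * lam) • (T⁻¹ * coordProj (J k)) - lam • T⁻¹ := by
        rw [hTdef]
        simp only [Matrix.mul_add, Matrix.mul_smul, Matrix.mul_one]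
        abel
      simp only [hx, this, Matrix.trace_sub, Matrix.trace_add, hTT, Matrix.trace_smul, smul_eq_mul]
      ring
    -- Disjointness: each nonnegative diagonal entry of `T⁻¹` is counted at most once.
    have e2 : ∑ k, (T⁻¹ * coordProj (J k)).trace ≤ T⁻¹.trace := by
      have : ∀ k, (T⁻¹ * coordProj (J k)).trace = ∑ i, if i ∈ J k then T⁻¹ i i else 0 := by
        intro k
        simp [Matrix.trace, coordProj, Matrix.mul_diagonal]
      simp only [this]
      rw [Finset.sum_comm]
      refine Finset.sum_le_sum fun i _ => ?_
      have hii : 0 ≤ T⁻¹ i i := hT.inv.posSemidef.diag_nonneg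
      by_cases hi : ∃ k, i ∈ J k
      · obtain ⟨k, hk⟩ := hi
        rw [Finset.sum_eq_single k]
        · simp [hk]
        · intro b _ hb
          have := Finset.disjoint_left.1 (hJ hb)
          by_cases h' : i ∈ J b
          · exact absurd hk (this h')
          · simp [h']
        · simp
      · push Not at hi
        simpa [hi] using hii
    have : ∑ k, x k = (N * lam) * ∑ k, (T⁻¹ * coordProj (J k)).trace - N * (lam * T⁻¹.trace) := by
      simp [e1, Finset.mul_sum, hN]
    rw [this]
    have := mul_le_mul_of_nonneg_left e2 (mul_nonneg hN0 hlam.le)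
    linarith
  calc N * √(T.det)⁻¹ ≤ √(T.det)⁻¹ * (N - (∑ k, x k) / 2) := by
        nlinarith [Real.sqrt_nonneg (T.det)⁻¹]
    _ = ∑ k, √(T.det)⁻¹ * (1 - x k / 2) := by
        have : ∑ k, (1 - x k / 2) = N - (∑ k, x k) / 2 := by
          rw [Finset.sum_div, Finset.sum_sub_distrib]; simp [hN]
        rw [← Finset.mul_sum, this]
    _ ≤ _ := Finset.sum_le_sum fun k _ => key k

/-! ### The Gram matrix of the rows -/

theorem gram_posSemidef {n d : ℕ} (A : Matrix (Fin n) (Fin d) ℝ) :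
    (A * A.transpose).PosSemidef := by
  simpa using Matrix.posSemidef_self_mul_conjTranspose A

theorem gram_posDef {n d : ℕ} {A : Matrix (Fin n) (Fin d) ℝ} (h : (A * A.transpose).det ≠ 0) :
    (A * A.transpose).PosDef := by
  refine (Matrix.PosSemidef.posDef_iff_isUnit (gram_posSemidef A)).2 ?_
  exact (Matrix.isUnit_iff_isUnit_det _).2 h.isUnit

theorem gram_det_nonneg {n d : ℕ} (A : Matrix (Fin n) (Fin d) ℝ) :
    0 ≤ (A * A.transpose).det := (gram_posSemidef A).det_nonneg

/-- `q` dominates the squared component of the `i`-th row of `A` orthogonal to the rows outside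
`J`. -/
def DominatesResidual {n d : ℕ} (A : Matrix (Fin n) (Fin d) ℝ) (J : Finset (Fin n))
    (i : Fin n) (q : ℝ) : Prop :=
  ∀ v : Fin d → ℝ, (∀ j ∉ J, A j ⬝ᵥ v = 0) → (A i ⬝ᵥ v) ^ 2 ≤ q * (v ⬝ᵥ v)

/-- Adding `κ` on the block `J` multiplies the determinant by roughly `κ / ρ i` for each `i ∈ J`.
Replacing the reciprocals of the residuals by an exponential makes the bound factor over the rows of
`J` and become integrable. -/
theorem gram_det_le {n d : ℕ} {A : Matrix (Fin n) (Fin d) ℝ} (hG : (A * A.transpose).PosDef)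
    (J : Finset (Fin n)) {ρ : Fin n → ℝ} (hρ : ∀ i ∈ J, DominatesResidual A J i (ρ i))
    {κ s : ℝ} (hκ : 0 < κ) (hs : 0 < s) :
    (A * A.transpose).det * (κ * s) ^ J.card ≤
      (A * A.transpose + κ • coordProj J).det * Real.exp (s * ∑ i ∈ J, ρ i) := by
  set G := A * A.transpose with hGdef
  set D := coordProj J with hD
  have hDD : D * D = D := by
    simp [hD, coordProj, Matrix.diagonal_mul_diagonal]
  have hDt : D.conjTranspose = D := (coordProj_posSemidef J).1
  have hGi : G * G⁻¹ = 1 := Matrix.mul_nonsing_inv _ hG.det_pos.ne'.isUnit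
  -- By Sylvester's identity, `T` carries the whole ratio of the two determinants.
  set T := 1 + κ • (D * G⁻¹ * D) with hTdef
  have hT : T.PosDef := by
    refine Matrix.PosDef.one.add_posSemidef (Matrix.PosSemidef.smul ?_ hκ.le)
    have := hG.inv.posSemidef.mul_mul_conjTranspose_same D
    rwa [hDt] at this
  have hdet : (G + κ • D).det = G.det * T.det := by
    have : G + κ • D = G * (1 + (κ • (G⁻¹ * D)) * D) := by
      rw [Matrix.mul_add, Matrix.mul_one, Matrix.smul_mul, Matrix.mul_smul,
        Matrix.mul_assoc G⁻¹, hDD, Matrix.mul_nonsing_inv_cancel_left _ _ hG.det_pos.ne'.isUnit]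
    rw [this, Matrix.det_mul, Matrix.det_one_add_mul_comm, Matrix.mul_smul, ← Matrix.mul_assoc]
  -- A diagonal comparison matrix: only the diagonal of `T⁻¹` enters the trace in the tangent
  -- inequality.
  set S : Matrix (Fin n) (Fin n) ℝ := Matrix.diagonal fun i => if i ∈ J then κ * s else 1 with hS
  have hSp : S.PosSemidef := Matrix.PosSemidef.diagonal fun i => by
    dsimp; split_ifs <;> positivity
  have hSdet : S.det = (κ * s) ^ J.card := by
    rw [hS, Matrix.det_diagonal, Finset.prod_ite]
    simp
  have h := det_le_det_mul_exp hSp hT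
  -- For `y = T⁻¹ eᵢ`, the vector `β` is orthogonal to the rows outside `J` and satisfies `y i =
  -- |y|² + κ |β|²`. If `i ∈ J`, the residual bound gives `(y i)² ≤ ρ i |β|² ≤ ρ i (y i) / κ`;
  -- otherwise `(y i)² ≤ |y|² ≤ y i`.
  have hdiag : ∀ i, T⁻¹ i i ≤ if i ∈ J then ρ i / κ else 1 := by
    intro i
    set y := T⁻¹.mulVec (Pi.single i 1) with hy
    have hTy : T.mulVec y = Pi.single i 1 := by
      rw [hy, Matrix.mulVec_mulVec, Matrix.mul_nonsing_inv _ hT.det_pos.ne'.isUnit,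
        Matrix.one_mulVec]
    have hyi : y i = T⁻¹ i i := by simp [hy]
    set β := A.transpose.mulVec (G⁻¹.mulVec (D.mulVec y)) with hβ
    have hAβ : A.mulVec β = D.mulVec y := by
      rw [hβ, Matrix.mulVec_mulVec, Matrix.mulVec_mulVec, ← hGdef, hGi, Matrix.one_mulVec]
    have hDy : ∀ j, D.mulVec y j = if j ∈ J then y j else 0 := by
      intro j
      simp [hD, coordProj, Matrix.mulVec_diagonal]
    have hββ : β ⬝ᵥ β = D.mulVec y ⬝ᵥ G⁻¹.mulVec (D.mulVec y) := by
      conv_lhs => enter [2]; rw [hβ]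
      rw [Matrix.dotProduct_mulVec, Matrix.vecMul_transpose, hAβ]
    have hTe : T.mulVec y = y + κ • D.mulVec (G⁻¹.mulVec (D.mulVec y)) := by
      generalize y = u
      rw [hTdef, Matrix.add_mulVec, Matrix.one_mulVec, Matrix.smul_mulVec, Matrix.mulVec_mulVec,
        Matrix.mulVec_mulVec, Matrix.mul_assoc]
    have hyy : y i = y ⬝ᵥ y + κ * (β ⬝ᵥ β) := by
      have h1 : y ⬝ᵥ T.mulVec y = y i := by rw [hTy]; simp
      rw [← h1, hTe, dotProduct_add, dotProduct_smul, smul_eq_mul, hββ, Matrix.dotProduct_mulVec y D]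
      congr 3
      rw [← Matrix.mulVec_transpose]
      congr 1
    have hnn : 0 ≤ β ⬝ᵥ β := by
      simpa [dotProduct, ← sq] using Finset.sum_nonneg fun j _ => sq_nonneg (β j)
    have hyy0 : y i ^ 2 ≤ y ⬝ᵥ y := by
      simp only [dotProduct, ← sq]
      exact Finset.single_le_sum (f := fun j => y j ^ 2) (fun j _ => sq_nonneg _)
        (Finset.mem_univ i)
    rw [← hyi]
    split_ifs with hi
    · have hA : ∀ j, A j ⬝ᵥ β = D.mulVec y j := fun j => by rw [← hAβ]; rfl
      have h1 := hρ i hi β (fun j hj => by rw [hA, hDy, if_neg hj])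
      rw [hA, hDy, if_pos hi] at h1
      rw [le_div_iff₀ hκ]
      -- The case `y i = 0` is vacuous, since the diagonal of `T⁻¹` is positive.
      rcases (show 0 ≤ y i by nlinarith [sq_nonneg (y i)]).eq_or_lt with h0 | h0
      · have hb : 0 ≤ ρ i := by
          have hr := hρ i hi
          by_contra hneg
          push Not at hneg
          have hAi : A i ≠ 0 := by
            intro hz
            have : G i i = 0 := by
              rw [hGdef, Matrix.mul_apply]
              simp [hz]
            exact hG.diag_pos.ne' this
          have hTi : 0 < T⁻¹ i i := hT.inv.diag_pos
          rw [← hyi, ← h0] at hTi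
          exact lt_irrefl _ hTi
        rw [← h0]; simpa using hb
      · have hρ0 : 0 ≤ ρ i := by
          by_contra hneg
          push Not at hneg
          nlinarith [mul_nonneg (neg_nonneg.2 hneg.le) hnn, pow_pos h0 2]
        have : κ * (β ⬝ᵥ β) ≤ y i := by nlinarith [sq_nonneg (y i)]
        nlinarith [mul_le_mul_of_nonneg_left this hρ0]
    · have : y i ^ 2 ≤ y i := by nlinarith [mul_nonneg hκ.le hnn]
      nlinarith [sq_nonneg (y i - 1)]
  have htr : (T⁻¹ * S).trace - Fintype.card (Fin n) ≤ s * ∑ i ∈ J, ρ i := by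
    have : (T⁻¹ * S).trace = ∑ i, T⁻¹ i i * (if i ∈ J then κ * s else 1) := by
      simp [Matrix.trace, hS, Matrix.mul_diagonal]
    rw [this]
    -- For `i ∈ J` the added `1` is not needed; this slack costs only a factor `exp (J.card)`.
    have h2 : ∑ i, T⁻¹ i i * (if i ∈ J then κ * s else 1) ≤
        ∑ i, ((if i ∈ J then s * ρ i else 0) + 1) := by
      refine Finset.sum_le_sum fun i _ => ?_
      have := hdiag i
      split_ifs with hi
      · rw [if_pos hi] at this
        have h3 := mul_le_mul_of_nonneg_right this (mul_pos hκ hs).le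
        have : ρ i / κ * (κ * s) = s * ρ i := by field_simp
        linarith
      · rw [if_neg hi] at this
        linarith
    rw [Finset.sum_add_distrib, Finset.sum_ite_mem, Finset.univ_inter, ← Finset.mul_sum] at h2
    simp at h2
    simp
    linarith
  rw [hdet, ← hSdet, mul_assoc]
  refine mul_le_mul_of_nonneg_left (h.trans ?_) hG.det_pos.le
  exact mul_le_mul_of_nonneg_left (Real.exp_le_exp.2 htr) hT.det_pos.le

/-- The minimal squared norm of an interpolating vector is a lower bound. -/
theorem quadForm_le_of_mulVec_eq {n d : ℕ} {A : Matrix (Fin n) (Fin d) ℝ}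
    (hG : (A * A.transpose).det ≠ 0) {α : Fin d → ℝ} {w : Fin n → ℝ} (h : A.mulVec α = w) :
    w ⬝ᵥ (A * A.transpose)⁻¹.mulVec w ≤ α ⬝ᵥ α := by
  set z := (A * A.transpose)⁻¹.mulVec w with hz
  -- The minimum-norm interpolant; the claim is `‖α - β‖² ≥ 0` expanded.
  set β := A.transpose.mulVec z with hβ
  have hAβ : A.mulVec β = w := by
    rw [hβ, Matrix.mulVec_mulVec, hz, Matrix.mulVec_mulVec, Matrix.mul_nonsing_inv _ hG.isUnit,
      Matrix.one_mulVec]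
  have h1 : ∀ u : Fin d → ℝ, u ⬝ᵥ β = A.mulVec u ⬝ᵥ z := by
    intro u
    rw [hβ, Matrix.dotProduct_mulVec, Matrix.vecMul_transpose]
  have h2 : 0 ≤ (α - β) ⬝ᵥ (α - β) := by
    simpa [dotProduct, ← sq] using Finset.sum_nonneg fun j _ => sq_nonneg (α j - β j)
  have h3 : (α - β) ⬝ᵥ (α - β) = α ⬝ᵥ α - 2 * (α ⬝ᵥ β) + β ⬝ᵥ β := by
    rw [sub_dotProduct, dotProduct_sub, dotProduct_sub, dotProduct_comm β α]; ring
  rw [h3, h1, h1, h, hAβ] at h2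
  linarith

/-- A diagonal entry of the inverse Gram matrix is at least the inverse of the squared residual
of the corresponding row. -/
theorem one_le_mul_inv_gram_diag {n d : ℕ} {A : Matrix (Fin n) (Fin d) ℝ}
    (hG : (A * A.transpose).det ≠ 0) {i : Fin n} {ρ : ℝ} (hρ : DominatesResidual A {i} i ρ) :
    1 ≤ ρ * (A * A.transpose)⁻¹ i i := by
  set M := (A * A.transpose)⁻¹ with hM
  -- The vector dual to row `i`: orthogonal to all other rows, with product one against row `i` and
  -- squared norm `M i i`.
  set β := A.transpose.mulVec (M.mulVec (Pi.single i 1)) with hβ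
  have hAβ : A.mulVec β = Pi.single i 1 := by
    rw [hβ, Matrix.mulVec_mulVec, hM, Matrix.mulVec_mulVec, Matrix.mul_nonsing_inv _ hG.isUnit,
      Matrix.one_mulVec]
  have hA : ∀ j, A j ⬝ᵥ β = (Pi.single i 1 : Fin n → ℝ) j := fun j => by rw [← hAβ]; rfl
  have h := hρ β (fun j hj => by rw [hA]; simp at hj; simp [hj])
  have hββ : β ⬝ᵥ β = M i i := by
    conv_lhs => enter [2]; rw [hβ]
    rw [Matrix.dotProduct_mulVec, Matrix.vecMul_transpose, hAβ]
    simp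
  rw [hA, hββ] at h
  simpa using h

/-- Interpolation of every output forces full row rank, so nondegeneracy of the features need not be
assumed separately. -/
theorem gram_det_ne_zero_of_surjective {n d : ℕ} {A : Matrix (Fin n) (Fin d) ℝ}
    (h : ∀ w, ∃ α, A.mulVec α = w) : (A * A.transpose).det ≠ 0 := by
  intro h0
  obtain ⟨z, hz, hz0⟩ := Matrix.exists_mulVec_eq_zero_iff.2 h0
  obtain ⟨α, hα⟩ := h z
  have h1 : A.transpose.mulVec z ⬝ᵥ A.transpose.mulVec z = 0 := by
    rw [Matrix.dotProduct_mulVec, Matrix.vecMul_transpose, Matrix.mulVec_mulVec, hz0,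
      zero_dotProduct]
  have h2 : A.transpose.mulVec z = 0 := dotProduct_self_eq_zero.1 h1
  have h3 : z ⬝ᵥ z = 0 := by
    conv_lhs => enter [2]; rw [← hα]
    rw [Matrix.dotProduct_mulVec, ← Matrix.mulVec_transpose, h2, zero_dotProduct]
  exact hz (dotProduct_self_eq_zero.1 h3)

/-- The residuals of the rows in `J` are dominated by quadratic forms that depend on the other
rows only: sums of squared coordinates along an orthonormal family. -/
theorem exists_orthonormal_dominatesResidual {n d : ℕ} (J : Finset (Fin n))
    (A : Matrix (Fin n) (Fin d) ℝ) :
    ∃ (r : ℕ) (b : Fin r → EuclideanSpace ℝ (Fin d)), Orthonormal ℝ b ∧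
      ∀ A' : Matrix (Fin n) (Fin d) ℝ, (∀ j ∉ J, A' j = A j) →
        ((A' * A'.transpose).det ≠ 0 → r + n = d + J.card) ∧
        ∀ i, DominatesResidual A' J i (∑ k, (A' i ⬝ᵥ (b k).ofLp) ^ 2) := by
  classical
  -- The span uses only rows outside `J`, so the basis of `Vᗮ` stays fixed while the rows in `J`
  -- vary. Full row rank fixes the dimension of `Vᗮ` at `d - (n - J.card)`.
  let V : Submodule ℝ (EuclideanSpace ℝ (Fin d)) :=
    Submodule.span ℝ (Set.range fun j : {j // j ∉ J} => WithLp.toLp 2 (A j))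
  let b := stdOrthonormalBasis ℝ Vᗮ
  refine ⟨Module.finrank ℝ Vᗮ, fun k => (b k : EuclideanSpace ℝ (Fin d)),
    b.orthonormal.comp_linearIsometry (Submodule.subtypeₗᵢ _),
    fun A' hA' => ⟨?_, ?_⟩⟩
  · intro hG
    have hli : LinearIndependent ℝ fun j : {j // j ∉ J} => WithLp.toLp 2 (A j) := by
      have hrows : LinearIndependent ℝ fun j : Fin n => A' j := by
        refine Fintype.linearIndependent_iff.2 fun g hg => ?_
        have h0 : Matrix.vecMul g A' = 0 := by
          rw [← hg]; ext k; simp [Matrix.vecMul, dotProduct]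
        have h1 : Matrix.vecMul g (A' * A'.transpose) = 0 := by
          rw [← Matrix.vecMul_vecMul, h0, Matrix.zero_vecMul]
        have h2 : g = 0 := by
          by_contra hne
          exact hG (Matrix.exists_vecMul_eq_zero_iff.1 ⟨g, hne, h1⟩)
        simp [h2]
      have := hrows.map' (WithLp.linearEquiv 2 ℝ (Fin d → ℝ)).symm.toLinearMap
        (LinearEquiv.ker _)
      have hfun : (fun j : {j // j ∉ J} => WithLp.toLp 2 (A j)) =
          (fun j : {j // j ∉ J} => WithLp.toLp 2 (A' j)) := funext fun j => by rw [hA' j j.2]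
      rw [hfun]
      exact this.comp _ Subtype.val_injective
    have h1 : Module.finrank ℝ V = Fintype.card {j // j ∉ J} := finrank_span_eq_card hli
    have h2 := Submodule.finrank_add_finrank_orthogonal V
    rw [h1] at h2
    have h3 : Fintype.card {j // j ∉ J} = n - J.card := by
      rw [Fintype.card_subtype_compl]; simp
    have h4 : J.card ≤ n := by simpa using J.card_le_univ
    have h5 : Module.finrank ℝ (EuclideanSpace ℝ (Fin d)) = d := by simp
    omega
  · intro i v hv
    have hmem : WithLp.toLp 2 v ∈ Vᗮ := by
      rw [Submodule.mem_orthogonal]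
      intro u hu
      induction hu using Submodule.span_induction with
      | mem x hx =>
        obtain ⟨j, rfl⟩ := hx
        have := hv j j.2
        rw [hA' j j.2] at this
        simpa [EuclideanSpace.inner_eq_star_dotProduct, dotProduct_comm v] using this
      | zero => simp
      | add x y _ _ hx hy => rw [inner_add_left, hx, hy, add_zero]
      | smul c x _ hx => rw [inner_smul_left, hx, mul_zero]
    have hrepr : v = ∑ k, (inner ℝ (b k : EuclideanSpace ℝ (Fin d)) (WithLp.toLp 2 v)) •
        (b k : EuclideanSpace ℝ (Fin d)).ofLp := by
      have h := congrArg Subtype.val (b.sum_repr' ⟨WithLp.toLp 2 v, hmem⟩)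
      have h' := congrArg WithLp.ofLp h
      simpa [WithLp.ofLp_sum] using h'.symm
    set c : Fin (Module.finrank ℝ Vᗮ) → ℝ := fun k =>
      inner ℝ (b k : EuclideanSpace ℝ (Fin d)) (WithLp.toLp 2 v) with hc
    have hcc : ∑ k, c k ^ 2 = v ⬝ᵥ v := by
      have h := b.sum_sq_norm_inner_right ⟨WithLp.toLp 2 v, hmem⟩
      have h2 : v ⬝ᵥ v = ‖WithLp.toLp 2 v‖ ^ 2 := by
        rw [EuclideanSpace.norm_sq_eq]; simp [dotProduct, sq]
      rw [h2]
      simpa using h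
    have h1 : A' i ⬝ᵥ v = ∑ k, (A' i ⬝ᵥ (b k : EuclideanSpace ℝ (Fin d)).ofLp) * c k := by
      conv_lhs => rw [hrepr]
      rw [dotProduct_sum]
      exact Finset.sum_congr rfl fun k _ => by rw [dotProduct_smul, smul_eq_mul, mul_comm]
    rw [h1, ← hcc]
    exact Finset.sum_mul_sq_le_sq_mul_sq _ _ _

/-! ### Gaussian vectors -/

theorem lintegral_pi_prod {ι : Type*} [Fintype ι] {Ω : ι → Type*} [∀ i, MeasurableSpace (Ω i)]
    (μ : ∀ i, Measure (Ω i)) [∀ i, IsProbabilityMeasure (μ i)] {f : ∀ i, Ω i → ENNReal}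
    (hf : ∀ i, Measurable (f i)) :
    ∫⁻ x, ∏ i, f i (x i) ∂(Measure.pi μ) = ∏ i, ∫⁻ y, f i y ∂(μ i) := by
  refine (lintegral_prod_eq_prod_lintegral_of_indepFun Finset.univ
    (fun i (x : ∀ i, Ω i) => f i (x i))
    (iIndepFun_pi fun i => (hf i).aemeasurable)
    fun i => (hf i).comp (measurable_pi_apply i)).trans ?_
  exact Finset.prod_congr rfl fun i _ => (measurePreserving_eval μ i).lintegral_comp (hf i)

/-- The law of `n` independent standard Gaussian variables. -/
noncomputable abbrev stdGaussianPi (ι : Type*) [Fintype ι] : Measure (ι → ℝ) :=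
  Measure.pi fun _ : ι => gaussianReal 0 1

theorem lintegral_exp_neg_mul_sq_gaussianReal {t : ℝ} (ht : 0 < 1 + t) :
    ∫⁻ x, ENNReal.ofReal (Real.exp (-(t * x ^ 2) / 2)) ∂(gaussianReal 0 1) =
      ENNReal.ofReal (√(1 + t)⁻¹) := by
  rw [gaussianReal_of_var_ne_zero _ one_ne_zero,
    lintegral_withDensity_eq_lintegral_mul _ (measurable_gaussianPDF _ _) (by fun_prop)]
  have h1 : ∀ x : ℝ, (gaussianPDF 0 1 * fun x => ENNReal.ofReal (Real.exp (-(t * x ^ 2) / 2))) x =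
      ENNReal.ofReal ((√(2 * Real.pi))⁻¹ * Real.exp (-((1 + t) / 2) * x ^ 2)) := by
    intro x
    rw [Pi.mul_apply, gaussianPDF, gaussianPDFReal, ← ENNReal.ofReal_mul (by positivity), mul_assoc,
      ← Real.exp_add]
    simp only [NNReal.coe_one, mul_one, sub_zero]
    congr 3
    ring
  simp only [h1]
  rw [← ofReal_integral_eq_lintegral_ofReal
    ((integrable_exp_neg_mul_sq (by positivity)).const_mul _)
    (Filter.Eventually.of_forall fun x => by positivity), integral_const_mul, integral_gaussian]
  congr 1
  rw [← Real.sqrt_inv, ← Real.sqrt_mul (by positivity)]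
  congr 1
  field_simp

theorem measurePreserving_sum_orthonormalBasis {ι : Type*} [Fintype ι]
    (b : OrthonormalBasis ι ℝ (EuclideanSpace ℝ ι)) :
    MeasurePreserving (fun (x : ι → ℝ) => (∑ i, x i • (b i).ofLp : ι → ℝ))
      (stdGaussianPi ι) (stdGaussianPi ι) := by
  refine ⟨by fun_prop, ?_⟩
  have h := map_pi_eq_stdGaussian (ι := ι)
  rw [stdGaussian_eq_map_pi_orthonormalBasis b] at h
  have h2 := congrArg (Measure.map (WithLp.ofLp : EuclideanSpace ℝ ι → ι → ℝ)) h
  rw [Measure.map_map (by fun_prop) (by fun_prop), Measure.map_map (by fun_prop) (by fun_prop)] at h2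
  have e1 : (WithLp.ofLp : EuclideanSpace ℝ ι → ι → ℝ) ∘ WithLp.toLp 2 = id := by ext; simp
  have e2 : (WithLp.ofLp : EuclideanSpace ℝ ι → ι → ℝ) ∘ (fun x : ι → ℝ => ∑ i, x i • b i) =
      fun x => ∑ i, x i • (b i).ofLp := by
    ext x j; simp [WithLp.ofLp_sum]
  rw [e1, e2, Measure.map_id] at h2
  exact h2.symm

theorem orthonormalBasis_dotProduct {ι : Type*} [Fintype ι] [DecidableEq ι]
    (b : OrthonormalBasis ι ℝ (EuclideanSpace ℝ ι)) (i j : ι) :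
    (b i).ofLp ⬝ᵥ (b j).ofLp = if i = j then 1 else 0 := by
  have := orthonormal_iff_ite.1 b.orthonormal j i
  rw [EuclideanSpace.inner_eq_star_dotProduct] at this
  simpa [eq_comm] using this

/-- A Gaussian integral. -/
theorem lintegral_exp_quadForm {ι : Type*} [Fintype ι] [DecidableEq ι] {S : Matrix ι ι ℝ}
    (hS : S.PosDef) :
    ∫⁻ w, ENNReal.ofReal (Real.exp (-(w ⬝ᵥ S.mulVec w - w ⬝ᵥ w) / 2)) ∂(stdGaussianPi ι) =
      ENNReal.ofReal (√(S.det)⁻¹) := by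
  -- Rotation to an eigenbasis of `S` preserves the law and splits the integral into one-dimensional
  -- ones.
  set b := hS.1.eigenvectorBasis with hb
  set ν := hS.1.eigenvalues with hν
  rw [← (measurePreserving_sum_orthonormalBasis b).lintegral_comp (by fun_prop)]
  have hSb : ∀ i, S.mulVec (b i).ofLp = ν i • (b i).ofLp := fun i => hS.1.mulVec_eigenvectorBasis i
  have hdot : ∀ x y : ι → ℝ, (∑ i, x i • (b i).ofLp) ⬝ᵥ (∑ i, y i • (b i).ofLp) =
      ∑ i, x i * y i := by
    intro x y
    simp [sum_dotProduct, dotProduct_sum, orthonormalBasis_dotProduct, mul_comm]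
  have hmul : ∀ x : ι → ℝ, S.mulVec (∑ i, x i • (b i).ofLp) =
      ∑ i, (ν i * x i) • (b i).ofLp := by
    intro x
    rw [Matrix.mulVec_sum]
    refine Finset.sum_congr rfl fun i _ => ?_
    rw [Matrix.mulVec_smul, hSb, smul_smul, mul_comm]
  have hint : ∀ x : ι → ℝ, ENNReal.ofReal (Real.exp (-((∑ i, x i • (b i).ofLp) ⬝ᵥ
      S.mulVec (∑ i, x i • (b i).ofLp) - (∑ i, x i • (b i).ofLp) ⬝ᵥ (∑ i, x i • (b i).ofLp)) / 2)) =
      ∏ i, ENNReal.ofReal (Real.exp (-((ν i - 1) * x i ^ 2) / 2)) := by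
    intro x
    rw [hmul, hdot, hdot, ← ENNReal.ofReal_prod_of_nonneg (fun _ _ => (Real.exp_pos _).le),
      ← Real.exp_sum, ← Finset.sum_div, Finset.sum_neg_distrib, ← Finset.sum_sub_distrib]
    congr 4
    exact Finset.sum_congr rfl fun i _ => by ring
  simp only [hint]
  rw [lintegral_pi_prod (fun _ : ι => gaussianReal 0 1)
    (f := fun i x => ENNReal.ofReal (Real.exp (-((ν i - 1) * x ^ 2) / 2))) (fun i => by fun_prop)]
  have hdet := hS.1.det_eq_prod_eigenvalues
  simp only [RCLike.ofReal_real_eq_id, id] at hdet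
  rw [hdet, ← Finset.prod_inv_distrib]
  have : ∀ i, ∫⁻ y, ENNReal.ofReal (Real.exp (-((ν i - 1) * y ^ 2) / 2)) ∂(gaussianReal 0 1) =
      ENNReal.ofReal (√(ν i)⁻¹) := by
    intro i
    have h : 0 < 1 + (ν i - 1) := by have := hS.eigenvalues_pos i; simpa [hν] using this
    rw [lintegral_exp_neg_mul_sq_gaussianReal h]
    congr 3; ring
  simp only [this]
  rw [← ENNReal.ofReal_prod_of_nonneg (fun _ _ => Real.sqrt_nonneg _)]
  rw [Real.sqrt_prod]
  intro i _
  exact inv_nonneg.2 (hS.eigenvalues_pos i).le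

theorem lintegral_exp_neg_mul_dotProduct_self {n : ℕ} {t : ℝ} (ht : 0 < 1 + t) :
    ∫⁻ w, ENNReal.ofReal (Real.exp (-(t * (w ⬝ᵥ w)) / 2)) ∂(stdGaussianPi (Fin n)) =
      ENNReal.ofReal (√((1 + t) ^ n)⁻¹) := by
  have h := lintegral_exp_quadForm
    (S := (1 + t) • (1 : Matrix (Fin n) (Fin n) ℝ)) (Matrix.PosDef.one.smul ht)
  rw [Matrix.det_smul, Matrix.det_one, mul_one, Fintype.card_fin] at h
  rw [← h]
  refine lintegral_congr fun w => ?_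
  rw [Matrix.smul_mulVec, Matrix.one_mulVec, dotProduct_smul, smul_eq_mul]
  congr 4
  ring

/-- The exponential moments of the squared norm of a Gaussian vector projected to the span of an
orthonormal family. -/
theorem lintegral_exp_sum_sq_orthonormal {d r : ℕ} {b : Fin r → EuclideanSpace ℝ (Fin d)}
    (hb : Orthonormal ℝ b) {s : ℝ} (hs0 : 0 ≤ s) (hs : s < 1) :
    ∫⁻ x, ENNReal.ofReal (Real.exp (s / 2 * ∑ k, (x ⬝ᵥ (b k).ofLp) ^ 2))
        ∂(stdGaussianPi (Fin d)) = ENNReal.ofReal (√((1 - s) ^ r)⁻¹) := by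
  set B : Matrix (Fin r) (Fin d) ℝ := Matrix.of fun k => (b k).ofLp with hB
  have hBB : B * B.transpose = 1 := by
    ext k l
    have := orthonormal_iff_ite.1 hb l k
    rw [EuclideanSpace.inner_eq_star_dotProduct] at this
    rw [Matrix.mul_apply, Matrix.one_apply]
    simpa [dotProduct, eq_comm, hB] using this
  have hBx : ∀ x : Fin d → ℝ, x ⬝ᵥ (B.transpose * B).mulVec x = ∑ k, (x ⬝ᵥ (b k).ofLp) ^ 2 := by
    intro x
    rw [← Matrix.mulVec_mulVec, Matrix.dotProduct_mulVec, Matrix.vecMul_transpose]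
    simp only [dotProduct, sq, Matrix.mulVec, hB, Matrix.of_apply, mul_comm]
  have hbessel : ∀ x : Fin d → ℝ, ∑ k, (x ⬝ᵥ (b k).ofLp) ^ 2 ≤ x ⬝ᵥ x := by
    intro x
    have h := hb.sum_inner_products_le (x := WithLp.toLp 2 x) (s := Finset.univ)
    rw [EuclideanSpace.norm_sq_eq] at h
    simpa [EuclideanSpace.inner_eq_star_dotProduct, dotProduct, ← sq] using h
  have hS : (1 - s • (B.transpose * B)).PosDef := by
    refine Matrix.PosDef.of_dotProduct_mulVec_pos ?_ fun {x} hx => ?_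
    · rw [Matrix.IsHermitian, Matrix.conjTranspose_sub, Matrix.conjTranspose_smul]
      simp
    · rw [Matrix.sub_mulVec, Matrix.one_mulVec, Matrix.smul_mulVec, dotProduct_sub, dotProduct_smul]
      have h1 : 0 < x ⬝ᵥ x := by
        rcases (show 0 ≤ x ⬝ᵥ x by
          simpa [dotProduct, ← sq] using Finset.sum_nonneg fun j _ => sq_nonneg (x j)).eq_or_lt
          with h | h
        · exact absurd (dotProduct_self_eq_zero.1 h.symm) hx
        · exact h
      have h2 := hbessel x
      simp only [star_trivial, hBx, smul_eq_mul]
      nlinarith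
  -- Sylvester's identity moves the determinant to dimension `r`, where `B Bᵀ = 1`.
  have hdet : (1 - s • (B.transpose * B)).det = (1 - s) ^ r := by
    rw [sub_eq_add_neg, ← Matrix.smul_mul, ← Matrix.neg_mul, Matrix.det_one_add_mul_comm,
      Matrix.mul_neg, Matrix.mul_smul, hBB, ← sub_eq_add_neg]
    have : (1 : Matrix (Fin r) (Fin r) ℝ) - s • 1 = (1 - s) • 1 := by rw [sub_smul, one_smul]
    rw [this, Matrix.det_smul, Matrix.det_one, mul_one, Fintype.card_fin]
  rw [← hdet, ← lintegral_exp_quadForm hS]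
  refine lintegral_congr fun x => ?_
  rw [Matrix.sub_mulVec, Matrix.one_mulVec, Matrix.smul_mulVec, dotProduct_sub, dotProduct_smul,
    hBx, smul_eq_mul]
  congr 2
  ring

/-- The law of a matrix with independent standard Gaussian entries is invariant under orthogonal
transformations of its columns. -/
theorem measurePreserving_mul_gaussian_matrix {n d : ℕ}
    (b : OrthonormalBasis (Fin n) ℝ (EuclideanSpace ℝ (Fin n))) :
    MeasurePreserving (fun (A : Fin n → Fin d → ℝ) => (fun i j => ∑ k, A k j * (b k).ofLp i))
      (Measure.pi fun _ : Fin n => stdGaussianPi (Fin d))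
      (Measure.pi fun _ : Fin n => stdGaussianPi (Fin d)) := by
  -- Transposition preserves the product law, which reduces the claim to rotating each column
  -- independently.
  have hT : ∀ m l : ℕ, MeasurePreserving (fun (A : Fin m → Fin l → ℝ) => fun j i => A i j)
      (Measure.pi fun _ : Fin m => stdGaussianPi (Fin l))
      (Measure.pi fun _ : Fin l => stdGaussianPi (Fin m)) := by
    intro m l
    have hc : ∀ m l : ℕ, MeasurePreserving (MeasurableEquiv.curry (Fin m) (Fin l) ℝ)
        (stdGaussianPi (Fin m × Fin l)) (Measure.pi fun _ : Fin m => stdGaussianPi (Fin l)) := by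
      intro m l
      refine ⟨MeasurableEquiv.measurable _, ?_⟩
      have := Measure.infinitePi_map_curry (fun (_ : Fin m) (_ : Fin l) => gaussianReal 0 1)
      simpa only [Measure.infinitePi_eq_pi] using this
    have hs : MeasurePreserving (MeasurableEquiv.piCongrLeft (fun _ => ℝ)
        (Equiv.prodComm (Fin m) (Fin l))) (stdGaussianPi (Fin m × Fin l))
        (stdGaussianPi (Fin l × Fin m)) :=
      measurePreserving_piCongrLeft (fun _ => gaussianReal 0 1) (Equiv.prodComm (Fin m) (Fin l))
    have := (hc l m).comp (hs.comp (hc m l).symm)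
    convert this using 1
    ext A j i
    simp [MeasurableEquiv.piCongrLeft, Equiv.piCongrLeft, MeasurableEquiv.curry]
  have h2 : MeasurePreserving
      (fun (A : Fin d → Fin n → ℝ) => fun j => (∑ k, A j k • (b k).ofLp : Fin n → ℝ))
      (Measure.pi fun _ : Fin d => stdGaussianPi (Fin n))
      (Measure.pi fun _ : Fin d => stdGaussianPi (Fin n)) :=
    measurePreserving_pi _ _ fun _ => measurePreserving_sum_orthonormalBasis b
  have := (hT d n).comp (h2.comp (hT n d))
  convert this using 1
  ext A i j
  simp

/-! ### Integrating out a block of rows -/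

/-- The Gram matrix of the rows of `A`. -/
noncomputable def gram {n d : ℕ} (A : Fin n → Fin d → ℝ) : Matrix (Fin n) (Fin n) ℝ :=
  Matrix.of A * (Matrix.of A).transpose

theorem continuous_gram {n d : ℕ} :
    Continuous (gram : (Fin n → Fin d → ℝ) → Matrix (Fin n) (Fin n) ℝ) := by
  unfold gram
  exact Continuous.matrix_mul continuous_id (Continuous.matrix_transpose continuous_id)

theorem measurable_gram_det {n d : ℕ} :
    Measurable fun A : Fin n → Fin d → ℝ => (gram A).det :=
  (continuous_gram.matrix_det).measurable

theorem measurable_gram_inv_apply {n d : ℕ} (i j : Fin n) :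
    Measurable fun A : Fin n → Fin d → ℝ => (gram A)⁻¹ i j := by
  simp only [Matrix.inv_def, Matrix.smul_apply, Ring.inverse_eq_inv', smul_eq_mul]
  exact measurable_gram_det.inv.mul
    ((continuous_apply_apply i j).comp continuous_gram.matrix_adjugate).measurable

theorem measurable_gram_quadForm {n d : ℕ} :
    Measurable fun ω : (Fin n → Fin d → ℝ) × (Fin n → ℝ) =>
      ω.2 ⬝ᵥ (gram ω.1)⁻¹.mulVec ω.2 := by
  simp only [dotProduct, Matrix.mulVec]
  refine Finset.measurable_sum _ fun i _ => ?_
  refine Measurable.mul (by fun_prop) (Finset.measurable_sum _ fun j _ => ?_)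
  exact ((measurable_gram_inv_apply i j).comp measurable_fst).mul (by fun_prop)

theorem measurableSet_gram_det_ne_zero {n d : ℕ} :
    MeasurableSet {A : Fin n → Fin d → ℝ | (gram A).det ≠ 0} :=
  measurable_gram_det (measurableSet_singleton 0).compl

/-- Fubini with the coordinates outside `J` frozen: `g` may depend on them, but its integral bound
`C` is uniform. -/
theorem lintegral_pi_le_of_le_prod {n : ℕ} {E : Type*} [MeasurableSpace E] [Inhabited E]
    {μ : Measure E} [IsProbabilityMeasure μ] (J : Finset (Fin n)) {f : (Fin n → E) → ENNReal}
    (hf : Measurable f) {C : ENNReal}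
    (h : ∀ A₀ : Fin n → E, ∃ g : E → ENNReal, Measurable g ∧ ∫⁻ x, g x ∂μ ≤ C ∧
      ∀ A : Fin n → E, (∀ j ∉ J, A j = A₀ j) → f A ≤ ∏ i ∈ J, g (A i)) :
    ∫⁻ A, f A ∂(Measure.pi fun _ : Fin n => μ) ≤ C ^ J.card := by
  classical
  obtain ⟨p, hp⟩ : ∃ p : Fin n → Prop, ∀ i, i ∈ J ↔ p i := ⟨fun i => i ∈ J, fun _ => Iff.rfl⟩
  have he := measurePreserving_piEquivPiSubtypeProd (fun _ : Fin n => μ) (p)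
  set e := MeasurableEquiv.piEquivPiSubtypeProd (fun _ : Fin n => E) (p) with he'
  rw [← he.symm.lintegral_comp hf, lintegral_prod_symm (fun z => f (e.symm z))
    (hf.comp e.symm.measurable).aemeasurable]
  refine (lintegral_mono (g := fun _ => C ^ J.card) fun y => ?_).trans (by simp)
  -- The default entries placed in `J` are immaterial, since the domination compares coordinates
  -- outside `J` only.
  obtain ⟨g, hg, hgC, hfg⟩ := h (e.symm (fun _ => default, y))
  have hin : ∀ (x : {i // p i} → E) (i : {i // p i}), e.symm (x, y) i = x i := by
    intro x i
    exact congrFun (congrArg Prod.fst (e.apply_symm_apply (x, y))) i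
  have hout : ∀ (x : {i // p i} → E) (i : {i // ¬ p i}), e.symm (x, y) i = y i := by
    intro x i
    exact congrFun (congrArg Prod.snd (e.apply_symm_apply (x, y))) i
  calc ∫⁻ x, f (e.symm (x, y)) ∂(Measure.pi fun _ => μ)
      ≤ ∫⁻ x, ∏ i : {i // p i}, g (x i) ∂(Measure.pi fun _ => μ) := by
        refine lintegral_mono fun x => (hfg _ ?_).trans ?_
        · intro j hj
          have hj' : ¬ p j := mt (hp j).2 hj
          rw [hout x ⟨j, hj'⟩, hout _ ⟨j, hj'⟩]
        · rw [Finset.prod_subtype J hp]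
          exact le_of_eq (Finset.prod_congr rfl fun i _ => by rw [hin])
    _ = ∏ _i : {i // p i}, ∫⁻ x, g x ∂μ :=
        lintegral_pi_prod (fun _ => μ) (f := fun _ => g) fun _ => hg
    _ ≤ C ^ J.card := by
        rw [Finset.prod_const, Finset.card_univ, Fintype.card_of_subtype J hp]
        gcongr

/-- Conditionally on the rows outside `J`, the residuals in `J` are quadratic forms in independent
rows, so an exponential of their sum integrates to a product. -/
theorem lintegral_le_of_dominatesResidual {n d : ℕ} {μ : Measure (Fin d → ℝ)}
    [IsProbabilityMeasure μ] (J : Finset (Fin n)) {f : (Fin n → Fin d → ℝ) → ENNReal}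
    (hf : Measurable f) {s : ℝ} {C : ENNReal}
    (hμ : ∀ (r : ℕ) (b : Fin r → EuclideanSpace ℝ (Fin d)), Orthonormal ℝ b →
      r + n = d + J.card →
      ∫⁻ x, ENNReal.ofReal (Real.exp (s * ∑ k, (x ⬝ᵥ (b k).ofLp) ^ 2)) ∂μ ≤ C)
    (hf0 : ∀ A, (gram A).det = 0 → f A = 0)
    (hfρ : ∀ A, (gram A).det ≠ 0 → ∀ ρ : Fin n → ℝ,
      (∀ i ∈ J, DominatesResidual (Matrix.of A) J i (ρ i)) →
      f A ≤ ENNReal.ofReal (Real.exp (s * ∑ i ∈ J, ρ i))) :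
    ∫⁻ A, f A ∂(Measure.pi fun _ : Fin n => μ) ≤ C ^ J.card := by
  classical
  refine lintegral_pi_le_of_le_prod J hf fun A₀ => ?_
  obtain ⟨r, b, hb, hbA⟩ := exists_orthonormal_dominatesResidual J (Matrix.of A₀)
  -- If the dimension is wrong, every matrix with these frozen rows has a singular Gram matrix and
  -- `f` vanishes there.
  by_cases hr : r + n = d + J.card
  · refine ⟨fun x => ENNReal.ofReal (Real.exp (s * ∑ k, (x ⬝ᵥ (b k).ofLp) ^ 2)), ?_, hμ r b hb hr,
      fun A hA => ?_⟩
    · simp only [dotProduct]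
      fun_prop
    · by_cases hdet : (gram A).det = 0
      · rw [hf0 A hdet]; exact zero_le
      · refine (hfρ A hdet (fun i => ∑ k, (A i ⬝ᵥ (b k).ofLp) ^ 2)
          fun i _ => (hbA (Matrix.of A) hA).2 i).trans (le_of_eq ?_)
        rw [← ENNReal.ofReal_prod_of_nonneg (fun _ _ => (Real.exp_pos _).le), ← Real.exp_sum,
          Finset.mul_sum]
  · refine ⟨0, measurable_zero, by simp, fun A hA => ?_⟩
    rw [hf0 A]
    · exact zero_le
    · by_contra hdet
      exact hr ((hbA (Matrix.of A) hA).1 hdet)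

theorem lintegral_sqrt_det_ratio_le {n d : ℕ} {μ : Measure (Fin d → ℝ)}
    [IsProbabilityMeasure μ] (J : Finset (Fin n)) {κ s c : ℝ} (hκ : 0 < κ) (hs : 0 < s)
    (hμ : ∀ (r : ℕ) (b : Fin r → EuclideanSpace ℝ (Fin d)), Orthonormal ℝ b →
      r + n = d + J.card →
      ∫⁻ x, ENNReal.ofReal (Real.exp (s * ∑ k, (x ⬝ᵥ (b k).ofLp) ^ 2)) ∂μ ≤
        ENNReal.ofReal (Real.exp c)) :
    ∫⁻ A, ENNReal.ofReal (√(gram A).det * √((gram A + κ • coordProj J).det)⁻¹)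
        ∂(Measure.pi fun _ : Fin n => μ) ≤
      ENNReal.ofReal (√((κ * (2 * s)) ^ J.card)⁻¹ * Real.exp (c * J.card)) := by
  set a := √((κ * (2 * s)) ^ J.card) with ha
  have hapos : 0 < a := Real.sqrt_pos.2 (by positivity)
  set F : (Fin n → Fin d → ℝ) → ℝ := fun A =>
    √(gram A).det * √((gram A + κ • coordProj J).det)⁻¹ with hF
  have hFm : Measurable F := by
    have h1 : Measurable fun A : Fin n → Fin d → ℝ => (gram A + κ • coordProj J).det :=
      ((continuous_gram.add continuous_const).matrix_det).measurable
    exact measurable_gram_det.sqrt.mul h1.inv.sqrt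
  have key := lintegral_le_of_dominatesResidual (μ := μ) J (f := fun A => ENNReal.ofReal (a * F A))
    (hFm.const_mul a).ennreal_ofReal (s := s) hμ (fun A hA => by simp [hF, hA]) ?_
  · have h2 : ∀ A, ENNReal.ofReal (F A) = ENNReal.ofReal a⁻¹ * ENNReal.ofReal (a * F A) := by
      intro A
      rw [← ENNReal.ofReal_mul (inv_nonneg.2 hapos.le), inv_mul_cancel_left₀ hapos.ne']
    change ∫⁻ A, ENNReal.ofReal (F A) ∂_ ≤ _
    simp only [h2]
    rw [lintegral_const_mul' _ _ ENNReal.ofReal_ne_top]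
    refine (mul_le_mul_right key _).trans (le_of_eq ?_)
    rw [← ENNReal.ofReal_pow (Real.exp_pos _).le, ← Real.exp_nat_mul, Real.sqrt_inv,
      ENNReal.ofReal_mul (inv_nonneg.2 hapos.le), mul_comm c]
  · intro A hA ρ hρ
    refine ENNReal.ofReal_le_ofReal ?_
    have hG := gram_posDef hA
    -- The parameter is doubled because the square root halves the exponent.
    have h := gram_det_le hG J hρ hκ (s := 2 * s) (by positivity)
    have hT : 0 < (gram A + κ • coordProj J).det :=
      (hG.add_posSemidef ((coordProj_posSemidef J).smul hκ.le)).det_pos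
    have h3 : (gram A).det * (κ * (2 * s)) ^ J.card * ((gram A + κ • coordProj J).det)⁻¹ ≤
        Real.exp (s * ∑ i ∈ J, ρ i) ^ 2 := by
      rw [← div_eq_mul_inv, div_le_iff₀ hT, ← Real.exp_nat_mul]
      refine h.trans (le_of_eq ?_)
      rw [mul_comm]
      congr 2
      push_cast; ring
    have h4 := Real.sqrt_le_sqrt h3
    rw [Real.sqrt_sq (Real.exp_pos _).le, Real.sqrt_mul (by
      have := gram_det_nonneg (Matrix.of A); exact mul_nonneg this (by positivity)),
      Real.sqrt_mul (show 0 ≤ (gram A).det from gram_det_nonneg (Matrix.of A))] at h4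
    calc a * F A = _ := by rw [hF, ha]; ring
      _ ≤ _ := h4

/-- Small ball estimate for the minimal squared norm of an interpolating vector. -/
theorem measure_quadForm_le {n d N l : ℕ} {μ : Measure (Fin d → ℝ)} [IsProbabilityMeasure μ]
    (hN : 0 < N) (J : Fin N → Finset (Fin n)) (hJ : Pairwise (Function.onFun Disjoint J))
    (hl : ∀ k, (J k).card = l) {lam s c τ : ℝ} (hlam : 0 < lam) (hs : 0 < s)
    (hμ : ∀ (r : ℕ) (b : Fin r → EuclideanSpace ℝ (Fin d)), Orthonormal ℝ b →
      r + n = d + l →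
      ∫⁻ x, ENNReal.ofReal (Real.exp (s * ∑ k, (x ⬝ᵥ (b k).ofLp) ^ 2)) ∂μ ≤
        ENNReal.ofReal (Real.exp c)) :
    ((Measure.pi fun _ : Fin n => μ).prod (stdGaussianPi (Fin n)))
        {ω | (gram ω.1).det ≠ 0 ∧ ω.2 ⬝ᵥ (gram ω.1)⁻¹.mulVec ω.2 ≤ τ} ≤
      ENNReal.ofReal (Real.exp (lam * τ / 2) *
        (√((N * lam * (2 * s)) ^ l)⁻¹ * Real.exp (c * l))) := by
  have hNr : (0 : ℝ) < N := by exact_mod_cast hN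
  -- Chernoff weight with the noise still present. The indicator is needed because `μ` may charge
  -- singular Gram matrices.
  set F : (Fin n → Fin d → ℝ) × (Fin n → ℝ) → ENNReal := fun ω =>
    {A | (gram A).det ≠ 0}.indicator (fun A => ENNReal.ofReal
      (Real.exp (lam * (τ - ω.2 ⬝ᵥ (gram A)⁻¹.mulVec ω.2) / 2))) ω.1 with hF
  have hdm := measurableSet_gram_det_ne_zero (n := n) (d := d)
  have hFm : Measurable F := by
    have hq := measurable_gram_quadForm (n := n) (d := d)
    have h1 : Measurable fun ω : (Fin n → Fin d → ℝ) × (Fin n → ℝ) => ENNReal.ofReal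
      (Real.exp (lam * (τ - ω.2 ⬝ᵥ (gram ω.1)⁻¹.mulVec ω.2) / 2)) := by fun_prop
    exact h1.indicator (measurable_fst hdm)
  refine (meas_le_lintegral₀ (f := F) hFm.aemeasurable ?_).trans ?_
  · rintro ⟨A, w⟩ ⟨h1, h2⟩
    simp only [hF]
    rw [Set.indicator_of_mem (by exact h1)]
    rw [ENNReal.one_le_ofReal]
    refine Real.one_le_exp ?_
    have : 0 ≤ τ - w ⬝ᵥ (gram A)⁻¹.mulVec w := sub_nonneg.2 h2
    positivity
  rw [lintegral_prod _ hFm.aemeasurable]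
  have hinner : ∀ A, ∫⁻ w, F (A, w) ∂(stdGaussianPi (Fin n)) ≤
      ENNReal.ofReal (Real.exp (lam * τ / 2) / N) * ∑ k, ENNReal.ofReal
        (√(gram A).det * √((gram A + (N * lam) • coordProj (J k)).det)⁻¹) := by
    intro A
    by_cases hA : (gram A).det = 0
    · have : ∀ w, F (A, w) = 0 := fun w => Set.indicator_of_notMem (by simpa using hA) _
      simp [this]
    have hG : (gram A).PosDef := gram_posDef hA
    have hF' : ∀ w, F (A, w) = ENNReal.ofReal (Real.exp (lam * τ / 2)) *
        ENNReal.ofReal (Real.exp (-(w ⬝ᵥ (1 + lam • (gram A)⁻¹).mulVec w - w ⬝ᵥ w) / 2)) := by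
      intro w
      simp only [hF]
      rw [Set.indicator_of_mem (by exact hA), ← ENNReal.ofReal_mul (Real.exp_pos _).le,
        ← Real.exp_add, Matrix.add_mulVec, Matrix.one_mulVec, Matrix.smul_mulVec, dotProduct_add,
        dotProduct_smul, smul_eq_mul]
      congr 2
      ring
    simp only [hF']
    rw [lintegral_const_mul' _ _ ENNReal.ofReal_ne_top,
      lintegral_exp_quadForm (Matrix.PosDef.one.add_posSemidef
        (hG.inv.posSemidef.smul hlam.le)), ← ENNReal.ofReal_mul (Real.exp_pos _).le,
      ← ENNReal.ofReal_sum_of_nonneg (fun _ _ => by positivity),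
      ← ENNReal.ofReal_mul (by positivity)]
    refine ENNReal.ofReal_le_ofReal ?_
    have hT : 0 < (gram A + lam • (1 : Matrix (Fin n) (Fin n) ℝ)).det :=
      (hG.add (Matrix.PosDef.one.smul hlam)).det_pos
    have hdet : (1 + lam • (gram A)⁻¹).det =
        (gram A + lam • (1 : Matrix (Fin n) (Fin n) ℝ)).det * ((gram A).det)⁻¹ := by
      have : gram A + lam • (1 : Matrix (Fin n) (Fin n) ℝ) =
          gram A * (1 + lam • (gram A)⁻¹) := by
        rw [Matrix.mul_add, Matrix.mul_one, Matrix.mul_smul,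
          Matrix.mul_nonsing_inv _ hG.det_pos.ne'.isUnit]
      rw [this, Matrix.det_mul]
      field_simp
    -- The full shift by `lam` is replaced by block shifts by `N * lam`, each involving only `l`
    -- rows.
    have hb := sqrt_inv_det_le_sum_blocks hG hlam J hJ
    rw [Fintype.card_fin] at hb
    rw [hdet, mul_inv, inv_inv, mul_comm _ (gram A).det, Real.sqrt_mul hG.det_pos.le,
      ← Finset.mul_sum, div_mul_eq_mul_div, mul_div_assoc _ _ (N : ℝ)]
    refine mul_le_mul_of_nonneg_left ?_ (Real.exp_pos _).le
    rw [le_div_iff₀ hNr]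
    have := mul_le_mul_of_nonneg_left hb (Real.sqrt_nonneg (gram A).det)
    linarith
  refine (lintegral_mono hinner).trans ?_
  have hm : ∀ k, Measurable fun A : Fin n → Fin d → ℝ => ENNReal.ofReal
        (√(gram A).det * √((gram A + (N * lam) • coordProj (J k)).det)⁻¹) := by
    intro k
    have h1 : Measurable fun A : Fin n → Fin d → ℝ =>
        (gram A + (N * lam) • coordProj (J k)).det :=
      ((continuous_gram.add continuous_const).matrix_det).measurable
    exact (measurable_gram_det.sqrt.mul h1.inv.sqrt).ennreal_ofReal
  rw [lintegral_const_mul' _ _ ENNReal.ofReal_ne_top, lintegral_finsetSum _ fun k _ => hm k]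
  have hk : ∀ k, ∫⁻ A, ENNReal.ofReal
      (√(gram A).det * √((gram A + (N * lam) • coordProj (J k)).det)⁻¹)
        ∂(Measure.pi fun _ : Fin n => μ) ≤
      ENNReal.ofReal (√((N * lam * (2 * s)) ^ l)⁻¹ * Real.exp (c * l)) := by
    intro k
    have := lintegral_sqrt_det_ratio_le (μ := μ) (J k) (κ := N * lam) (c := c) (by positivity) hs
      (by rw [hl k]; exact hμ)
    rwa [hl k] at this
  refine (mul_le_mul_right (Finset.sum_le_sum fun k _ => hk k) _).trans (le_of_eq ?_)
  rw [Finset.sum_const, Finset.card_univ, Fintype.card_fin, nsmul_eq_mul, ← mul_assoc,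
    ENNReal.ofReal_mul (Real.exp_pos (lam * τ / 2)).le]
  congr 1
  rw [← ENNReal.ofReal_natCast, ← ENNReal.ofReal_mul (by positivity)]
  congr 1
  field_simp

/-! ### Sparse vectors -/

/-- A volumetric substitute for a covering argument: an exponential integral over the unit ball
controls the operator norm. -/
theorem exp_norm_sq_le_lintegral_ball {E F : Type*} [NormedAddCommGroup E] [InnerProductSpace ℝ E]
    [FiniteDimensional ℝ E] [MeasurableSpace E] [BorelSpace E] [NormedAddCommGroup F]
    [NormedSpace ℝ F] (μ : Measure E) [μ.IsAddHaarMeasure] (T : E →L[ℝ] F) {u : E} (hu : ‖u‖ ≤ 1)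
    {s ε x : ℝ} (hs : 0 ≤ s) (hε : 0 < ε) (hε' : ε < 1 / 2) (hx : x ≤ ‖T u‖ ^ 2) :
    ENNReal.ofReal (ε ^ Module.finrank ℝ E * Real.exp (s * (1 - 2 * ε) ^ 2 * x)) *
        μ (Metric.ball 0 1) ≤
      ∫⁻ v in Metric.ball 0 1, ENNReal.ofReal (Real.exp (s * ‖T v‖ ^ 2)) ∂μ := by
  -- At a maximizer `u₀` of `‖T v‖`, the ball of radius `ε` about `(1 - ε) u₀` lies in the unit
  -- ball, carries the fraction `ε ^ dim` of its volume, and has `‖T v‖ ≥ (1 - 2 ε) ‖T u₀‖`.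
  obtain ⟨u₀, hu₀, hmax⟩ := (isCompact_closedBall (0 : E) 1).exists_isMaxOn
    ⟨0, by simp⟩ (f := fun v => ‖T v‖) (by fun_prop)
  rw [mem_closedBall_zero_iff] at hu₀
  set M := ‖T u₀‖ with hM
  have hTM : ∀ v, ‖T v‖ ≤ M * ‖v‖ := by
    intro v
    rcases eq_or_ne v 0 with rfl | hv
    · simp
    have hv' : 0 < ‖v‖ := norm_pos_iff.2 hv
    have h := hmax (a := ‖v‖⁻¹ • v) (by
      rw [mem_closedBall_zero_iff, norm_smul, norm_inv, norm_norm, inv_mul_cancel₀ hv'.ne'])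
    simp only [Set.mem_ofPred_eq, map_smul, norm_smul, norm_inv, norm_norm] at h
    rwa [inv_mul_le_iff₀ hv', mul_comm] at h
  have hxM : x ≤ M ^ 2 := hx.trans
    (pow_le_pow_left₀ (norm_nonneg _) (hmax (mem_closedBall_zero_iff.2 hu)) 2)
  have hsub : Metric.ball ((1 - ε) • u₀) ε ⊆ Metric.ball 0 1 := by
    intro v hv
    rw [mem_ball_zero_iff]
    rw [Metric.mem_ball, dist_eq_norm] at hv
    calc ‖v‖ = ‖(v - (1 - ε) • u₀) + (1 - ε) • u₀‖ := by rw [sub_add_cancel]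
      _ ≤ ‖v - (1 - ε) • u₀‖ + ‖(1 - ε) • u₀‖ := norm_add_le _ _
      _ < ε + (1 - ε) * 1 := by
        rw [norm_smul, Real.norm_of_nonneg (by linarith)]
        exact add_lt_add_of_lt_of_le hv (mul_le_mul_of_nonneg_left hu₀ (by linarith))
      _ = 1 := by ring
  have hlow : ∀ v ∈ Metric.ball ((1 - ε) • u₀) ε, s * (1 - 2 * ε) ^ 2 * x ≤ s * ‖T v‖ ^ 2 := by
    intro v hv
    rw [Metric.mem_ball, dist_eq_norm] at hv
    have h1 : (1 - ε) * M ≤ ‖T v‖ + M * ε := by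
      calc (1 - ε) * M = ‖T ((1 - ε) • u₀)‖ := by
            rw [map_smul, norm_smul, Real.norm_of_nonneg (by linarith)]
        _ = ‖T v - T (v - (1 - ε) • u₀)‖ := by rw [map_sub, sub_sub_cancel]
        _ ≤ ‖T v‖ + ‖T (v - (1 - ε) • u₀)‖ := norm_sub_le _ _
        _ ≤ ‖T v‖ + M * ε := by
          refine add_le_add_right ((hTM _).trans ?_) _
          exact mul_le_mul_of_nonneg_left hv.le (norm_nonneg _)
    have hM0 : 0 ≤ M := norm_nonneg _
    have h2 : ((1 - 2 * ε) * M) ^ 2 ≤ ‖T v‖ ^ 2 :=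
      pow_le_pow_left₀ (mul_nonneg (by linarith) hM0) (by linarith) 2
    calc s * (1 - 2 * ε) ^ 2 * x ≤ s * (1 - 2 * ε) ^ 2 * M ^ 2 :=
          mul_le_mul_of_nonneg_left hxM (by positivity)
      _ = s * ((1 - 2 * ε) * M) ^ 2 := by ring
      _ ≤ _ := mul_le_mul_of_nonneg_left h2 hs
  calc ENNReal.ofReal (ε ^ Module.finrank ℝ E * Real.exp (s * (1 - 2 * ε) ^ 2 * x)) *
        μ (Metric.ball 0 1)
      = ENNReal.ofReal (Real.exp (s * (1 - 2 * ε) ^ 2 * x)) *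
          μ (Metric.ball ((1 - ε) • u₀) ε) := by
        rw [Measure.addHaar_ball_of_pos μ _ hε, mul_comm (ε ^ _),
          ENNReal.ofReal_mul (Real.exp_pos _).le, mul_assoc]
    _ = ∫⁻ v in Metric.ball ((1 - ε) • u₀) ε,
          ENNReal.ofReal (Real.exp (s * (1 - 2 * ε) ^ 2 * x)) ∂μ := by
        rw [setLIntegral_const]
    _ ≤ ∫⁻ v in Metric.ball ((1 - ε) • u₀) ε, ENNReal.ofReal (Real.exp (s * ‖T v‖ ^ 2)) ∂μ := by
        refine setLIntegral_mono' measurableSet_ball fun v hv => ?_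
        exact ENNReal.ofReal_le_ofReal (Real.exp_le_exp.2 (hlow v hv))
    _ ≤ _ := lintegral_mono_set hsub

/-- Uniform exponential moments of the squared one-dimensional marginals. -/
def HasExpSqMoments {d : ℕ} (μ : Measure (Fin d → ℝ)) (s c : ℝ) : Prop :=
  ∀ v : Fin d → ℝ, v ⬝ᵥ v ≤ 1 →
    ∫⁻ x, ENNReal.ofReal (Real.exp (s * (x ⬝ᵥ v) ^ 2)) ∂μ ≤ ENNReal.ofReal (Real.exp c)

/-- Extension of a vector supported on `S` by zero. -/
noncomputable def extendZero {d : ℕ} (S : Finset (Fin d)) (v : EuclideanSpace ℝ S) : Fin d → ℝ :=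
  fun j => if h : j ∈ S then v ⟨j, h⟩ else 0

theorem dotProduct_extendZero {d : ℕ} (S : Finset (Fin d)) (x : Fin d → ℝ)
    (v : EuclideanSpace ℝ S) : x ⬝ᵥ extendZero S v = ∑ j : S, x j * v j := by
  rw [Finset.sum_coe_sort_eq_attach, dotProduct]
  rw [← Finset.sum_subset (Finset.subset_univ S) (fun j _ hj => by simp [extendZero, hj]),
    ← Finset.sum_attach]
  exact Finset.sum_congr rfl fun j _ => by simp [extendZero]

/-- The average of `exp (s ‖A v‖²)` over the unit ball of the vectors supported on `S`. -/
noncomputable def ballAverage {n d : ℕ} (s : ℝ) (S : Finset (Fin d)) (A : Fin n → Fin d → ℝ) : ENNReal :=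
  (volume (Metric.ball (0 : EuclideanSpace ℝ S) 1))⁻¹ *
    ∫⁻ v in Metric.ball (0 : EuclideanSpace ℝ S) 1,
      ENNReal.ofReal (Real.exp (s * ∑ i, (A i ⬝ᵥ extendZero S v) ^ 2))

theorem measurable_ballAverage_integrand {n d : ℕ} (s : ℝ) (S : Finset (Fin d)) :
    Measurable fun z : (Fin n → Fin d → ℝ) × EuclideanSpace ℝ S =>
      ENNReal.ofReal (Real.exp (s * ∑ i, (z.1 i ⬝ᵥ extendZero S z.2) ^ 2)) := by
  simp only [dotProduct_extendZero]
  fun_prop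

theorem measurable_ballAverage {n d : ℕ} (s : ℝ) (S : Finset (Fin d)) :
    Measurable (ballAverage s S : (Fin n → Fin d → ℝ) → ENNReal) :=
  (measurable_ballAverage_integrand s S).lintegral_prod_right'.const_mul _

theorem lintegral_ballAverage_le {n d : ℕ} {μ : Measure (Fin d → ℝ)} [IsProbabilityMeasure μ]
    {s c : ℝ} (hμ : HasExpSqMoments μ s c) (S : Finset (Fin d)) :
    ∫⁻ A, ballAverage s S A ∂(Measure.pi fun _ : Fin n => μ) ≤
      ENNReal.ofReal (Real.exp (n * c)) := by
  unfold ballAverage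
  have hm := measurable_ballAverage_integrand (n := n) s S
  rw [lintegral_const_mul _ hm.lintegral_prod_right', lintegral_lintegral_swap hm.aemeasurable]
  -- For fixed `v` the rows are independent, so the moment bound is used once per row.
  have hin : ∀ v ∈ Metric.ball (0 : EuclideanSpace ℝ S) 1,
      ∫⁻ A, ENNReal.ofReal (Real.exp (s * ∑ i, (A i ⬝ᵥ extendZero S v) ^ 2))
        ∂(Measure.pi fun _ : Fin n => μ) ≤ ENNReal.ofReal (Real.exp (n * c)) := by
    intro v hv
    rw [mem_ball_zero_iff] at hv
    have hvv : extendZero S v ⬝ᵥ extendZero S v ≤ 1 := by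
      have h1 : extendZero S v ⬝ᵥ extendZero S v = ‖v‖ ^ 2 := by
        rw [dotProduct_extendZero, EuclideanSpace.norm_sq_eq]
        exact Finset.sum_congr rfl fun j _ => by simp [extendZero, sq]
      rw [h1]
      exact pow_le_one₀ (norm_nonneg _) hv.le
    have h2 : ∀ A : Fin n → Fin d → ℝ,
        ENNReal.ofReal (Real.exp (s * ∑ i, (A i ⬝ᵥ extendZero S v) ^ 2)) =
        ∏ i, ENNReal.ofReal (Real.exp (s * (A i ⬝ᵥ extendZero S v) ^ 2)) := by
      intro A
      rw [Finset.mul_sum, Real.exp_sum,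
        ENNReal.ofReal_prod_of_nonneg fun _ _ => (Real.exp_pos _).le]
    simp only [h2]
    rw [lintegral_pi_prod (fun _ : Fin n => μ)
      (f := fun _ x => ENNReal.ofReal (Real.exp (s * (x ⬝ᵥ extendZero S v) ^ 2)))
      (fun _ => by simp only [dotProduct]; fun_prop)]
    rw [Finset.prod_const, Finset.card_univ, Fintype.card_fin, Real.exp_nat_mul,
      ENNReal.ofReal_pow (Real.exp_pos _).le]
    exact pow_le_pow_left₀ zero_le (hμ _ hvv) n
  refine (mul_le_mul_right (setLIntegral_mono measurable_const hin) _).trans ?_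
  rw [setLIntegral_const, mul_comm, mul_assoc, ENNReal.mul_inv_cancel, mul_one]
  · exact (Metric.measure_ball_pos _ _ one_pos).ne'
  · exact measure_ball_lt_top.ne

theorem le_ballAverage {n d : ℕ} {S : Finset (Fin d)} (A : Fin n → Fin d → ℝ) {u : Fin d → ℝ}
    (huS : ∀ j ∉ S, u j = 0) (hu : u ⬝ᵥ u ≤ 1) {s ε x : ℝ} (hs : 0 ≤ s) (hε : 0 < ε)
    (hε' : ε < 1 / 2) (hx : x ≤ ∑ i, (A i ⬝ᵥ u) ^ 2) :
    ENNReal.ofReal (ε ^ S.card * Real.exp (s * (1 - 2 * ε) ^ 2 * x)) ≤ ballAverage s S A := by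
  set B : Matrix (Fin n) S ℝ := Matrix.of fun i j => A i j with hB
  set T : EuclideanSpace ℝ S →L[ℝ] EuclideanSpace ℝ (Fin n) :=
    LinearMap.toContinuousLinearMap (Matrix.toEuclideanLin B) with hT
  have hTv : ∀ v : EuclideanSpace ℝ S, ‖T v‖ ^ 2 = ∑ i, (A i ⬝ᵥ extendZero S v) ^ 2 := by
    intro v
    rw [EuclideanSpace.norm_sq_eq]
    refine Finset.sum_congr rfl fun i _ => ?_
    rw [dotProduct_extendZero]
    simp [hT, hB, Matrix.toLpLin_apply, Matrix.mulVec, dotProduct]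
  set v : EuclideanSpace ℝ S := WithLp.toLp 2 fun j => u j with hv
  have hvu : extendZero S v = u := by
    ext j
    by_cases hj : j ∈ S
    · simp [extendZero, hj, hv]
    · simp [extendZero, hj, huS j hj]
  have hvn : ‖v‖ ≤ 1 := by
    have h1 : ‖v‖ ^ 2 = u ⬝ᵥ u := by
      conv_rhs => rw [← hvu]
      rw [dotProduct_extendZero, EuclideanSpace.norm_sq_eq]
      exact Finset.sum_congr rfl fun j _ => by simp [extendZero, sq]
    nlinarith [norm_nonneg v]
  have h := exp_norm_sq_le_lintegral_ball volume T hvn hs hε hε' (x := x) (by rwa [hTv, hvu])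
  simp only [hTv] at h
  rw [finrank_euclideanSpace, Fintype.card_coe] at h
  rw [ballAverage, ← ENNReal.div_eq_inv_mul, ENNReal.le_div_iff_mul_le]
  · exact h
  · exact Or.inl (Metric.measure_ball_pos _ _ one_pos).ne'
  · exact Or.inl measure_ball_lt_top.ne

theorem choose_le_exp {n d : ℕ} (hn : 1 ≤ n) (hnd : n < d) :
    (d.choose n : ℝ) ≤ Real.exp (n * (Real.log ((d : ℝ) / n) + 1)) := by
  have hn0 : (0 : ℝ) < n := by exact_mod_cast hn
  have hd0 : (0 : ℝ) < d := by exact_mod_cast (by omega : 0 < d)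
  have h1 : (d.choose n : ℝ) ≤ (d : ℝ) ^ n / n.factorial := Nat.choose_le_pow_div n d
  have h2 := Real.pow_div_factorial_le_exp (n : ℝ) hn0.le n
  rw [mul_add, mul_one, Real.exp_add, Real.exp_nat_mul, Real.exp_log (by positivity)]
  calc (d.choose n : ℝ) ≤ (d : ℝ) ^ n / n.factorial := h1
    _ = ((d : ℝ) / n) ^ n * ((n : ℝ) ^ n / n.factorial) := by
        rw [div_pow]; field_simp
    _ ≤ _ := mul_le_mul_of_nonneg_left h2 (by positivity)

theorem log_one_sub_le {x : ℝ} (hx : 0 ≤ x) (hx1 : x < 1) :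
    Real.log (1 - x) ≤ -(x + x ^ 2 / 2 + x ^ 3 / 3) := by
  have h := Real.hasSum_pow_div_log_of_abs_lt_one (x := x) (by rwa [abs_of_nonneg hx])
  have h2 := sum_le_hasSum (Finset.range 3) (fun i _ => by positivity) h
  norm_num [Finset.sum_range_succ] at h2
  linarith

theorem sqrt_inv_pow_eq_exp {a : ℝ} (ha : 0 < a) (n : ℕ) :
    √(a ^ n)⁻¹ = Real.exp (-(n * Real.log a) / 2) := by
  rw [Real.sqrt_eq_iff_mul_self_eq (by positivity) (by positivity), ← Real.exp_add]
  have : -(n * Real.log a) / 2 + -(n * Real.log a) / 2 = -(n * Real.log a) := by ring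
  rw [this, Real.exp_neg, Real.exp_nat_mul, Real.exp_log ha]

theorem exp_mul_le_of_convex {p z : ℝ} (hp0 : 0 ≤ p) (hp1 : p ≤ 1) :
    Real.exp (p * z) ≤ (1 - p) + p * Real.exp z := by
  have h := convexOn_exp.2 (Set.mem_univ (0 : ℝ)) (Set.mem_univ z) (sub_nonneg.2 hp1) hp0
    (by ring)
  simpa using h

/-- With high probability, no vector with `n` nonzero coefficients and small norm has an image of
norm comparable to that of the noise. -/
theorem measure_exists_sparse_le {n d : ℕ} (hn : 1 ≤ n) (hnd : n < d) {μ : Measure (Fin d → ℝ)}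
    [IsProbabilityMeasure μ] {s c ε C δ : ℝ} (hμ : HasExpSqMoments μ s c) (hs : 0 < s)
    (hc : 0 ≤ c) (hε : 0 < ε) (hε' : ε < 1 / 2) (hδ : 0 < δ) (hδ1 : δ < 1)
    (hC : Real.log ((d : ℝ) / n) + 1 + c - Real.log ε ≤
      3 / 4 * (C * Real.log ((d : ℝ) / n) * (s * (1 - 2 * ε) ^ 2))) :
    ((Measure.pi fun _ : Fin n => μ).prod (stdGaussianPi (Fin n)))
        {ω | ∃ S : Finset (Fin d), S.card = n ∧ ∃ u : Fin d → ℝ, (∀ j ∉ S, u j = 0) ∧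
          u ⬝ᵥ u ≤ 1 ∧ C * Real.log ((d : ℝ) / n) / (1 - δ) * (ω.2 ⬝ᵥ ω.2) ≤
            ∑ i, (ω.1 i ⬝ᵥ u) ^ 2} ≤
      ENNReal.ofReal (Real.exp (-(n * δ ^ 2 / 2))) := by
  have hn0 : (0 : ℝ) < n := by exact_mod_cast hn
  have hL : 0 < Real.log ((d : ℝ) / n) :=
    Real.log_pos (by rw [lt_div_iff₀ hn0, one_mul]; exact_mod_cast hnd)
  set L := Real.log ((d : ℝ) / n) with hLdef
  set s₀ := s * (1 - 2 * ε) ^ 2 with hs₀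
  have hs₀pos : 0 < s₀ := mul_pos hs (pow_pos (by linarith) 2)
  have hlogε : Real.log ε < 0 := Real.log_neg hε (by linarith)
  -- The cost per row: `L + 1` from counting supports, `c` from the moments, `-log ε` from the ball
  -- average.
  set B := L + 1 + c - Real.log ε with hB
  have hB1 : 1 ≤ B := by linarith
  have hCLs : 4 / 3 ≤ C * L * s₀ := by linarith
  have hCL : 0 < C * L := by
    by_contra h
    push Not at h
    nlinarith
  have hC0 : C ≠ 0 := fun h => by simp [h] at hCL
  have h1δ : 0 < 1 - δ := by linarith
  -- Chosen so that `1 + 2 t = (4 / 3) / (1 - δ)`, the base of the Gaussian Laplace transform of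
  -- `‖w‖²`.
  set t := (1 / 3 + δ) / (1 - δ) / 2 with ht
  have htpos : 0 < t := by positivity
  -- With this power, `p s₀ x = t ‖w‖²` at the threshold value `x`, so the weights in `A` and `w`
  -- cancel.
  set p := t * (1 - δ) / (C * L * s₀) with hp
  have htδ : t * (1 - δ) = (1 / 3 + δ) / 2 := by rw [ht]; field_simp
  have hp0 : 0 ≤ p := by positivity
  have hp1 : p ≤ 1 := by
    rw [hp, div_le_one (by positivity), htδ]
    linarith
  have hpB : p * B ≤ 3 / 8 * (1 / 3 + δ) := by
    have : p * B ≤ p * (3 / 4 * (C * L * s₀)) := mul_le_mul_of_nonneg_left hC hp0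
    refine this.trans (le_of_eq ?_)
    have h2 : p * (C * L * s₀) = t * (1 - δ) := by rw [hp]; field_simp
    linear_combination 3 / 4 * h2 + 3 / 4 * htδ
  -- A majorant of the `p`-th power of the normalized exponential, obtained from convexity; its mean
  -- is at most one.
  set Ψ : (Fin n → Fin d → ℝ) → ENNReal := fun A =>
    ENNReal.ofReal (1 - p) + ENNReal.ofReal (p * Real.exp (-(n * B)) * (ε ^ n)⁻¹) *
      ∑ S ∈ Finset.powersetCard n Finset.univ, ballAverage s S A with hΨ
  have hΨm : Measurable Ψ := by
    refine Measurable.const_add (Measurable.const_mul ?_ _) _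
    exact Finset.measurable_fun_sum _ fun S _ => measurable_ballAverage s S
  set g : (Fin n → ℝ) → ENNReal := fun w =>
    ENNReal.ofReal (Real.exp (-(2 * t * (w ⬝ᵥ w)) / 2)) with hg
  have hgm : Measurable g := by simp only [hg, dotProduct]; fun_prop
  have hΨint : ∫⁻ A, Ψ A ∂(Measure.pi fun _ : Fin n => μ) ≤ 1 := by
    rw [hΨ, lintegral_add_left measurable_const, lintegral_const, measure_univ, mul_one,
      lintegral_const_mul' _ _ ENNReal.ofReal_ne_top,
      lintegral_finsetSum _ fun S _ => measurable_ballAverage s S]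
    have h1 : ∑ S ∈ Finset.powersetCard n (Finset.univ : Finset (Fin d)),
        ∫⁻ A, ballAverage s S A ∂(Measure.pi fun _ : Fin n => μ) ≤
        ENNReal.ofReal (Real.exp (n * (L + 1)) * Real.exp (n * c)) := by
      refine (Finset.sum_le_sum fun S _ => lintegral_ballAverage_le hμ S).trans ?_
      rw [Finset.sum_const, Finset.card_powersetCard, Finset.card_univ, Fintype.card_fin,
        nsmul_eq_mul, ENNReal.ofReal_mul (Real.exp_pos _).le]
      refine mul_le_mul_left ?_ _
      rw [← ENNReal.ofReal_natCast]
      exact ENNReal.ofReal_le_ofReal (choose_le_exp hn hnd)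
    refine (add_le_add_right (mul_le_mul_right h1 _) _).trans ?_
    rw [← ENNReal.ofReal_mul (by positivity), ← ENNReal.ofReal_add (by linarith) (by positivity),
      ← ENNReal.ofReal_one]
    refine ENNReal.ofReal_le_ofReal (le_of_eq ?_)
    have h2 : (ε ^ n)⁻¹ = Real.exp (-(n * Real.log ε)) := by
      rw [Real.exp_neg, Real.exp_nat_mul, Real.exp_log hε]
    rw [h2, mul_assoc, mul_assoc, ← Real.exp_add, ← Real.exp_add, ← Real.exp_add]
    have : -(n * B) + (-(n * Real.log ε) + (n * (L + 1) + n * c)) = 0 := by rw [hB]; ring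
    rw [this, Real.exp_zero]; ring
  refine (meas_le_lintegral₀ (f := fun ω => ENNReal.ofReal (Real.exp (p * (n * B))) *
    (Ψ ω.1 * g ω.2)) ?_ ?_).trans ?_
  · exact (((hΨm.comp measurable_fst).mul (hgm.comp measurable_snd)).const_mul _).aemeasurable
  · rintro ⟨A, w⟩ ⟨S, hS, u, huS, hu, hxu⟩
    set x := C * L / (1 - δ) * (w ⬝ᵥ w) with hx
    have h1 := le_ballAverage A huS hu hs.le hε hε' (x := x) hxu
    rw [hS, ← hs₀] at h1
    have h2 : ENNReal.ofReal (Real.exp (p * (s₀ * x - n * B))) ≤ Ψ A := by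
      refine (ENNReal.ofReal_le_ofReal (exp_mul_le_of_convex hp0 hp1)).trans ?_
      rw [ENNReal.ofReal_add (by linarith) (by positivity)]
      refine add_le_add_right ?_ _
      refine le_trans ?_ (mul_le_mul_right (h1.trans (Finset.single_le_sum
        (f := fun S => ballAverage s S A) (fun _ _ => zero_le)
        (Finset.mem_powersetCard.2 ⟨Finset.subset_univ S, hS⟩))) _)
      rw [← ENNReal.ofReal_mul (by positivity)]
      refine ENNReal.ofReal_le_ofReal (le_of_eq ?_)
      rw [sub_eq_add_neg, Real.exp_add]
      field_simp
    have h3 : p * (s₀ * x) = t * (w ⬝ᵥ w) := by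
      rw [hp, hx]; field_simp
    calc (1 : ENNReal) = ENNReal.ofReal (Real.exp (p * (n * B))) *
          (ENNReal.ofReal (Real.exp (p * (s₀ * x - n * B))) * g w) := by
          rw [hg, ← ENNReal.ofReal_mul (Real.exp_pos _).le, ← ENNReal.ofReal_mul (Real.exp_pos _).le,
            ← Real.exp_add, ← Real.exp_add]
          have : p * (n * B) + (p * (s₀ * x - n * B) + -(2 * t * (w ⬝ᵥ w)) / 2) = 0 := by
            linear_combination h3
          rw [this, Real.exp_zero, ENNReal.ofReal_one]
      _ ≤ _ := by gcongr
  · rw [lintegral_const_mul' _ _ ENNReal.ofReal_ne_top,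
      lintegral_prod_mul hΨm.aemeasurable hgm.aemeasurable, hg,
      lintegral_exp_neg_mul_dotProduct_self (by positivity)]
    refine (mul_le_mul_right (mul_le_mul_left hΨint _) _).trans ?_
    rw [one_mul, ← ENNReal.ofReal_mul (Real.exp_pos _).le]
    refine ENNReal.ofReal_le_ofReal ?_
    rw [sqrt_inv_pow_eq_exp (by positivity), ← Real.exp_add]
    refine Real.exp_le_exp.2 ?_
    have h1 : 1 + 2 * t = (4 / 3) / (1 - δ) := by rw [ht]; field_simp; ring
    have h2 : Real.log (1 + 2 * t) = Real.log (4 / 3) - Real.log (1 - δ) := by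
      rw [h1, Real.log_div (by norm_num) h1δ.ne']
    have h3 := log_one_sub_le hδ.le hδ1
    have h4 : (1 / 4 : ℝ) ≤ Real.log (4 / 3) := by
      have := Real.one_sub_inv_le_log_of_pos (show (0 : ℝ) < 4 / 3 by norm_num)
      norm_num at this
      linarith
    -- The constants `1 / 4` cancel, and what remains is `δ (δ² / 3 - δ / 2 + 1 / 4) ≥ 0`, whose
    -- quadratic factor has no real root.
    have h5 : 2 * (p * B) - Real.log (1 + 2 * t) ≤ -δ ^ 2 := by
      rw [h2]
      nlinarith [mul_nonneg hδ.le (sq_nonneg (δ - 3 / 4)), sq_nonneg (δ - 3 / 4)]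
    have h6 := mul_le_mul_of_nonneg_left h5 hn0.le
    linarith

/-! ### Exponential moments of Gaussian and sub-Gaussian vectors -/

theorem HasExpSqMoments.gaussian {d : ℕ} {s : ℝ} (hs : 0 < s) (hs' : s < 1 / 2) :
    HasExpSqMoments (stdGaussianPi (Fin d)) s (-(Real.log (1 - 2 * s)) / 2) := by
  intro v hv
  have hlog : Real.log (1 - 2 * s) ≤ 0 := Real.log_nonpos (by linarith) (by linarith)
  rcases eq_or_ne v 0 with rfl | hv0
  · simp only [dotProduct_zero]
    simp
    linarith
  set V : EuclideanSpace ℝ (Fin d) := WithLp.toLp 2 v with hV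
  have hVn : ‖V‖ ^ 2 = v ⬝ᵥ v := by
    rw [EuclideanSpace.norm_sq_eq]; simp [dotProduct, sq, hV]
  have hV0 : 0 < ‖V‖ := norm_pos_iff.2 fun h => hv0 (by
    have := congrArg WithLp.ofLp h
    simpa [hV] using this)
  set b : Fin 1 → EuclideanSpace ℝ (Fin d) := fun _ => ‖V‖⁻¹ • V with hb
  have hbo : Orthonormal ℝ b := by
    refine ⟨fun _ => ?_, fun i j hij => absurd (Subsingleton.elim i j) hij⟩
    rw [hb, norm_smul, norm_inv, norm_norm, inv_mul_cancel₀ hV0.ne']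
  -- The normalized vector is an orthonormal family of size one; `2 * s` offsets the factor `1 / 2`
  -- in the exponent of that lemma.
  have h := lintegral_exp_sum_sq_orthonormal hbo (s := 2 * s) (by linarith) (by linarith)
  rw [sqrt_inv_pow_eq_exp (by linarith)] at h
  refine (lintegral_mono fun x => ENNReal.ofReal_le_ofReal (Real.exp_le_exp.2 ?_)).trans
    (h.le.trans (le_of_eq (by norm_num)))
  have h1 : x ⬝ᵥ v = ‖V‖ * (x ⬝ᵥ (b 0).ofLp) := by
    simp only [hb, WithLp.ofLp_smul, dotProduct_smul, smul_eq_mul, hV]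
    rw [mul_inv_cancel_left₀ hV0.ne']
  rw [h1, Fin.sum_univ_one, mul_pow, hVn]
  have := mul_le_mul_of_nonneg_right hv (sq_nonneg (x ⬝ᵥ (b 0).ofLp))
  nlinarith

theorem natCast_pow_le_factorial_mul_exp (k : ℕ) :
    (k : ℝ) ^ k ≤ k.factorial * Real.exp k := by
  have := Real.pow_div_factorial_le_exp (k : ℝ) (Nat.cast_nonneg k) k
  rwa [div_le_iff₀ (by positivity), mul_comm] at this

theorem lintegral_enorm_pow_le_of_isSubGaussianVar {p : ℕ} {P : Measure (Fin p → ℝ)}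
    [IsProbabilityMeasure P] {Z : (Fin p → ℝ) → ℝ} {K : ℝ} (hK : 0 < K)
    (hZ : IsSubGaussianVar P Z K) (k : ℕ) :
    ∫⁻ x, ENNReal.ofReal (Z x ^ (2 * k)) ∂P ≤ ENNReal.ofReal ((2 * K ^ 2 * k) ^ k) := by
  rcases Nat.eq_zero_or_pos k with rfl | hk
  · simp
  have hk1 : (1 : ℝ) ≤ k := by exact_mod_cast hk
  set q : ℝ := 2 * k with hq
  have hq0 : 0 < q := by positivity
  have h := hZ q (by linarith)
  rw [eLpNorm_eq_lintegral_rpow_enorm_toReal (by simpa using hq0) ENNReal.ofReal_ne_top,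
    ENNReal.toReal_ofReal hq0.le] at h
  have h2 := ENNReal.rpow_le_rpow h hq0.le
  rw [← ENNReal.rpow_mul, one_div, inv_mul_cancel₀ hq0.ne', ENNReal.rpow_one] at h2
  have hqn : q = ((2 * k : ℕ) : ℝ) := by push_cast; rfl
  refine le_trans (le_of_eq (lintegral_congr fun x => ?_)) (h2.trans (le_of_eq ?_))
  · rw [hqn, ENNReal.rpow_natCast, Real.enorm_eq_ofReal_abs, ← ENNReal.ofReal_pow (abs_nonneg _),
      Even.pow_abs (even_two_mul k)]
  · rw [hqn, ENNReal.rpow_natCast, ← ENNReal.ofReal_pow (by positivity), pow_mul, mul_pow,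
      Real.sq_sqrt (by positivity)]
    congr 2
    push_cast; ring

/-- Expand the exponential in even moments. Since `E Z^(2k) ≤ (2 K² k)^k` and `k^k ≤ k! e^k`, the
choice of `s` makes the `k`-th term at most `2^(-k)`; the sum `2` accounts for `log 2`. -/
theorem HasExpSqMoments.of_isSubGaussianFeature {p d : ℕ} {P : Measure (Fin p → ℝ)}
    [IsProbabilityMeasure P] {a : (Fin p → ℝ) → (Fin d → ℝ)} (ha : Measurable a) {K : ℝ}
    (hK : 0 < K) (h : IsSubGaussianFeature P a K) :
    HasExpSqMoments (P.map a) (1 / (4 * Real.exp 1 * K ^ 2)) (Real.log 2) := by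
  set s := 1 / (4 * Real.exp 1 * K ^ 2) with hs
  have hs0 : 0 < s := by positivity
  intro v hv
  rw [Real.exp_log two_pos, lintegral_map (by simp only [dotProduct]; fun_prop) ha]
  rcases eq_or_ne v 0 with rfl | hv0
  · simp
  set Z : (Fin p → ℝ) → ℝ := fun x => (a x ⬝ᵥ v) / √(sqNorm v) with hZ
  have hvv : sqNorm v = v ⬝ᵥ v := by simp [sqNorm, dotProduct, sq]
  have hvpos : 0 < v ⬝ᵥ v := by
    rcases (show 0 ≤ v ⬝ᵥ v by
      simpa [dotProduct, ← sq] using Finset.sum_nonneg fun j _ => sq_nonneg (v j)).eq_or_lt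
      with h | h
    · exact absurd (dotProduct_self_eq_zero.1 h.symm) hv0
    · exact h
  have hZm : Measurable Z := by simp only [hZ, dotProduct]; fun_prop
  have hexp : ∀ x, ENNReal.ofReal (Real.exp (s * Z x ^ 2)) =
      ∑' k : ℕ, ENNReal.ofReal (s ^ k / k.factorial) * ENNReal.ofReal (Z x ^ (2 * k)) := by
    intro x
    have h1 : ∀ k : ℕ, ENNReal.ofReal (s ^ k / k.factorial) * ENNReal.ofReal (Z x ^ (2 * k)) =
        ENNReal.ofReal ((s * Z x ^ 2) ^ k / k.factorial) := by
      intro k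
      rw [← ENNReal.ofReal_mul (by positivity), mul_pow, ← pow_mul]
      congr 1; ring
    simp only [h1]
    rw [← ENNReal.ofReal_tsum_of_nonneg (fun k => by positivity)
      (Real.summable_pow_div_factorial _), Real.exp_eq_exp_ℝ, NormedSpace.exp_eq_tsum_div]
  have hterm : ∀ k : ℕ, ENNReal.ofReal (s ^ k / k.factorial) *
      ∫⁻ x, ENNReal.ofReal (Z x ^ (2 * k)) ∂P ≤ ENNReal.ofReal ((1 / 2) ^ k) := by
    intro k
    refine (mul_le_mul_right (lintegral_enorm_pow_le_of_isSubGaussianVar hK (h v hv0) k) _).trans ?_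
    rw [← ENNReal.ofReal_mul (by positivity)]
    refine ENNReal.ofReal_le_ofReal ?_
    have h1 := natCast_pow_le_factorial_mul_exp k
    have h2 : (1 / 2 : ℝ) ^ k = (s * (2 * K ^ 2)) ^ k * Real.exp k := by
      rw [show Real.exp (k : ℝ) = Real.exp 1 ^ k by rw [← Real.exp_nat_mul, mul_one], ← mul_pow]
      congr 1
      rw [hs]; field_simp; norm_num
    rw [h2, mul_pow s, mul_pow (2 * K ^ 2) (k : ℝ), div_mul_eq_mul_div, div_le_iff₀ (by positivity)]
    calc s ^ k * ((2 * K ^ 2) ^ k * (k : ℝ) ^ k)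
        ≤ s ^ k * ((2 * K ^ 2) ^ k * (k.factorial * Real.exp k)) := by gcongr
      _ = _ := by ring
  calc ∫⁻ x, ENNReal.ofReal (Real.exp (s * (a x ⬝ᵥ v) ^ 2)) ∂P
      ≤ ∫⁻ x, ENNReal.ofReal (Real.exp (s * Z x ^ 2)) ∂P := by
        refine lintegral_mono fun x => ENNReal.ofReal_le_ofReal (Real.exp_le_exp.2 ?_)
        refine mul_le_mul_of_nonneg_left ?_ hs0.le
        rw [hZ, hvv, div_pow, Real.sq_sqrt hvpos.le, le_div_iff₀ hvpos]
        exact mul_le_of_le_one_right (sq_nonneg _) hv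
    _ = ∑' k : ℕ, ENNReal.ofReal (s ^ k / k.factorial) *
          ∫⁻ x, ENNReal.ofReal (Z x ^ (2 * k)) ∂P := by
        simp only [hexp]
        rw [lintegral_tsum fun k => by fun_prop]
        exact tsum_congr fun k => lintegral_const_mul' _ _ ENNReal.ofReal_ne_top
    _ ≤ ∑' k : ℕ, ENNReal.ofReal ((1 / 2) ^ k) := ENNReal.tsum_le_tsum hterm
    _ = ENNReal.ofReal 2 := by
        rw [← ENNReal.ofReal_tsum_of_nonneg (fun k => by positivity)
          (summable_geometric_of_lt_one (by norm_num) (by norm_num)), tsum_geometric_two]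

/-- Jensen's inequality over the `r` directions. It replaces independence of coordinates, at the
price of dividing `s` by `r`. -/
theorem HasExpSqMoments.lintegral_exp_sum_sq_le {d r : ℕ} {μ : Measure (Fin d → ℝ)} {s c : ℝ}
    (hμ : HasExpSqMoments μ s c) (hr : 0 < r) {b : Fin r → EuclideanSpace ℝ (Fin d)}
    (hb : Orthonormal ℝ b) :
    ∫⁻ x, ENNReal.ofReal (Real.exp (s / r * ∑ k, (x ⬝ᵥ (b k).ofLp) ^ 2)) ∂μ ≤
      ENNReal.ofReal (Real.exp c) := by
  have hr0 : (0 : ℝ) < r := by exact_mod_cast hr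
  have hjensen : ∀ x : Fin d → ℝ, ENNReal.ofReal
      (Real.exp (s / r * ∑ k, (x ⬝ᵥ (b k).ofLp) ^ 2)) ≤
      ENNReal.ofReal (r : ℝ)⁻¹ * ∑ k, ENNReal.ofReal (Real.exp (s * (x ⬝ᵥ (b k).ofLp) ^ 2)) := by
    intro x
    rw [← ENNReal.ofReal_sum_of_nonneg (fun _ _ => (Real.exp_pos _).le),
      ← ENNReal.ofReal_mul (by positivity)]
    refine ENNReal.ofReal_le_ofReal ?_
    have h := convexOn_exp.map_sum_le (t := Finset.univ) (w := fun _ : Fin r => (r : ℝ)⁻¹)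
      (p := fun k => s * (x ⬝ᵥ (b k).ofLp) ^ 2) (fun _ _ => by positivity)
      (by simp [hr0.ne']) (fun _ _ => Set.mem_univ _)
    simp only [smul_eq_mul, ← Finset.mul_sum] at h
    refine le_trans (le_of_eq ?_) h
    congr 1
    ring
  refine (lintegral_mono hjensen).trans ?_
  rw [lintegral_const_mul' _ _ ENNReal.ofReal_ne_top,
    lintegral_finsetSum _ fun k _ => by simp only [dotProduct]; fun_prop]
  have hk : ∀ k, ∫⁻ x, ENNReal.ofReal (Real.exp (s * (x ⬝ᵥ (b k).ofLp) ^ 2)) ∂μ ≤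
      ENNReal.ofReal (Real.exp c) := by
    intro k
    refine hμ _ (le_of_eq ?_)
    have h1 : ‖b k‖ ^ 2 = (b k).ofLp ⬝ᵥ (b k).ofLp := by
      rw [EuclideanSpace.norm_sq_eq]; simp [dotProduct, sq]
    rw [← h1, hb.1 k, one_pow]
  refine (mul_le_mul_right (Finset.sum_le_sum fun k _ => hk k) _).trans (le_of_eq ?_)
  rw [Finset.sum_const, Finset.card_univ, Fintype.card_fin, nsmul_eq_mul, ← mul_assoc,
    ← ENNReal.ofReal_natCast, ← ENNReal.ofReal_mul (by positivity), inv_mul_cancel₀ hr0.ne',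
    ENNReal.ofReal_one, one_mul]

/-! ### The minimal norm of an interpolating vector when `d ≤ 2 n` -/

theorem exists_disjoint_blocks {n N l : ℕ} (h : N * l ≤ n) :
    ∃ J : Fin N → Finset (Fin n), Pairwise (Function.onFun Disjoint J) ∧ ∀ k, (J k).card = l := by
  let f : Fin N × Fin l ↪ Fin n :=
    finProdFinEquiv.toEmbedding.trans (Fin.castLEEmb h)
  refine ⟨fun k => Finset.univ.map ⟨fun j => f (k, j), fun i j hij => ?_⟩, ?_, fun k => by simp⟩
  · exact (Prod.mk.inj (f.injective hij)).2
  · intro k k' hk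
    rw [Function.onFun, Finset.disjoint_left]
    intro i hi hi'
    simp only [Finset.mem_map, Finset.mem_univ, true_and] at hi hi'
    obtain ⟨j, rfl⟩ := hi
    obtain ⟨j', hj'⟩ := hi'
    exact hk (Prod.mk.inj (f.injective hj')).1.symm

theorem measure_quadForm_le_of_hasExpSqMoments {n d : ℕ} (hn : 1 ≤ n) (hnd : n < d)
    (hd : d ≤ 2 * n) {μ : Measure (Fin d → ℝ)} [IsProbabilityMeasure μ] {s c : ℝ}
    (hμ : HasExpSqMoments μ s c) (hs : 0 < s) :
    ((Measure.pi fun _ : Fin n => μ).prod (stdGaussianPi (Fin n)))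
        {ω | (gram ω.1).det ≠ 0 ∧ ω.2 ⬝ᵥ (gram ω.1)⁻¹.mulVec ω.2 ≤
          1 / (2 * (Real.exp (2 * c + 4) / s) * Real.log ((d : ℝ) / n))} ≤
      ENNReal.ofReal (Real.exp (-(n * Real.log ((d : ℝ) / n)))) := by
  set L := Real.log ((d : ℝ) / n) with hL
  set κ := Real.exp (2 * c + 4) / s with hκ
  have hκ0 : 0 < κ := by positivity
  obtain ⟨l, rfl⟩ : ∃ l, d = n + l := ⟨d - n, by omega⟩
  have hl : 0 < l := by omega
  have hln : l ≤ n := by omega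
  -- Blocks have size `l = d - n`. As `l ≤ n`, rounding down loses at most a factor two: `n ≤ 2 N
  -- l`.
  set N := n / l with hN
  have hN0 : 0 < N := Nat.div_pos hln hl
  have hn0 : (0 : ℝ) < n := by exact_mod_cast hn
  have hl0 : (0 : ℝ) < l := by exact_mod_cast hl
  have hN0' : (0 : ℝ) < N := by exact_mod_cast hN0
  have hlnR : (l : ℝ) ≤ n := by exact_mod_cast hln
  have hN2 : (n : ℝ) ≤ 2 * N * l := by
    have h1 : n < l * (N + 1) := Nat.lt_mul_div_succ n hl
    have h2 : n ≤ 2 * N * l := by nlinarith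
    exact_mod_cast h2
  have hdn : ((n + l : ℕ) : ℝ) / n = 1 + l / n := by push_cast; field_simp
  have hLlow : (l : ℝ) / (2 * n) ≤ L := by
    rw [hL, hdn]
    have h1 := Real.one_sub_inv_le_log_of_pos (show (0 : ℝ) < 1 + l / n by positivity)
    refine le_trans ?_ h1
    rw [show 1 - (1 + (l : ℝ) / n)⁻¹ = l / (n + l) by field_simp; ring]
    exact div_le_div_of_nonneg_left hl0.le (by positivity) (by linarith)
  have hL0 : 0 < L := lt_of_lt_of_le (by positivity) hLlow
  have hLup : n * L ≤ l := by
    have h1 := Real.log_le_sub_one_of_pos (show (0 : ℝ) < 1 + l / n by positivity)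
    rw [← hdn, ← hL, hdn] at h1
    have h2 := mul_le_mul_of_nonneg_left h1 hn0.le
    have h3 : (n : ℝ) * (1 + l / n - 1) = l := by field_simp; ring
    linarith
  obtain ⟨J, hJ, hJl⟩ := exists_disjoint_blocks (n := n) (N := N) (l := l) (Nat.div_mul_le_self n l)
  -- Residuals live in dimension `d - n + l = 2 l`, hence `s / (2 l)`. The value of `lam` makes the
  -- base `N * lam * (2 * s / (2 * l))` equal to `exp (2 c + 4)`.
  have h := measure_quadForm_le (μ := μ) hN0 J hJ hJl (lam := κ * l / N) (s := s / (2 * l : ℕ))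
    (c := c) (τ := 1 / (2 * κ * L)) (by positivity) (by positivity) (fun r b hb hr => by
      obtain rfl : r = 2 * l := by omega
      exact hμ.lintegral_exp_sum_sq_le (by omega) hb)
  refine h.trans (ENNReal.ofReal_le_ofReal ?_)
  have h1 : (N : ℝ) * (κ * l / N) * (2 * (s / (2 * l : ℕ))) = Real.exp (2 * c + 4) := by
    rw [hκ]; push_cast; field_simp
  rw [h1, sqrt_inv_pow_eq_exp (Real.exp_pos _), Real.log_exp, ← Real.exp_add, ← Real.exp_add]
  refine Real.exp_le_exp.2 ?_
  -- Exponent budget: `-(c + 2) l` from the determinant, `c l` from the moments, and at most `l`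
  -- from the threshold leave `-l ≤ -n L`.
  have h2 : κ * l / N * (1 / (2 * κ * L)) / 2 = l / (4 * N * L) := by
    field_simp; norm_num
  have h3 : (l : ℝ) / (4 * N * L) ≤ l := by
    have h4 : 1 ≤ 4 * N * L := by
      have h5 : 1 ≤ 4 * N * ((l : ℝ) / (2 * n)) := by
        rw [← mul_div_assoc, le_div_iff₀ (by positivity)]
        linarith
      exact h5.trans (mul_le_mul_of_nonneg_left hLlow (by positivity))
    exact div_le_self hl0.le h4
  rw [h2]
  linarith

/-! ### The minimal norm of an interpolating vector for Gaussian features -/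

/-- For Gaussian matrices, the direction of the right-hand side is immaterial. -/
theorem gaussian_measure_quadForm_le_eq {n d : ℕ} (i₀ : Fin n) (w : Fin n → ℝ) (τ : ℝ) :
    (Measure.pi fun _ : Fin n => stdGaussianPi (Fin d))
        {A | (gram A).det ≠ 0 ∧ w ⬝ᵥ (gram A)⁻¹.mulVec w ≤ τ} =
      (Measure.pi fun _ : Fin n => stdGaussianPi (Fin d))
        {A | (gram A).det ≠ 0 ∧ (w ⬝ᵥ w) * (gram A)⁻¹ i₀ i₀ ≤ τ} := by
  rcases eq_or_ne w 0 with rfl | hw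
  · simp
  set V : EuclideanSpace ℝ (Fin n) := WithLp.toLp 2 w with hV
  have hVn : ‖V‖ ^ 2 = w ⬝ᵥ w := by
    rw [EuclideanSpace.norm_sq_eq]; simp [dotProduct, sq, hV]
  have hV0 : 0 < ‖V‖ := norm_pos_iff.2 fun h => hw (by
    have := congrArg WithLp.ofLp h
    simpa [hV] using this)
  -- A rotation whose `i₀`-th basis vector is `w / ‖w‖`; conjugation by it turns the form into a
  -- diagonal entry.
  obtain ⟨b, hb⟩ := Orthonormal.exists_orthonormalBasis_extension_of_card_eq (𝕜 := ℝ)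
    (E := EuclideanSpace ℝ (Fin n)) (ι := Fin n) (by simp) (v := fun _ => ‖V‖⁻¹ • V)
    (s := {i₀}) (by
      refine ⟨fun _ => ?_, fun i j hij => absurd (Subsingleton.elim i j) hij⟩
      rw [Set.domRestrict_apply, norm_smul, norm_inv, norm_norm, inv_mul_cancel₀ hV0.ne'])
  have hb0 : b i₀ = ‖V‖⁻¹ • V := hb i₀ rfl
  set U : Matrix (Fin n) (Fin n) ℝ := Matrix.of fun i k => (b k).ofLp i with hU
  have hUU : U.transpose * U = 1 := by
    ext i j
    rw [Matrix.mul_apply, Matrix.one_apply, ← orthonormalBasis_dotProduct b i j]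
    rfl
  have hUU' : U * U.transpose = 1 := mul_eq_one_comm.1 hUU
  have hR := measurePreserving_mul_gaussian_matrix (d := d) b
  set R : (Fin n → Fin d → ℝ) → (Fin n → Fin d → ℝ) := fun A i j => ∑ k, A k j * (b k).ofLp i
  have hgram : ∀ A, gram (R A) = U * gram A * U.transpose := by
    intro A
    have h1 : Matrix.of (R A) = U * Matrix.of A := by
      ext i j
      simp [R, hU, Matrix.mul_apply, mul_comm]
    rw [gram, h1, Matrix.transpose_mul, gram]
    simp only [Matrix.mul_assoc]
  have hinv : ∀ A, (gram (R A))⁻¹ = U * (gram A)⁻¹ * U.transpose := by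
    intro A
    have hUi : U⁻¹ = U.transpose := Matrix.inv_eq_left_inv hUU
    have hUi' : U.transpose⁻¹ = U := Matrix.inv_eq_left_inv hUU'
    rw [hgram, Matrix.mul_inv_rev, Matrix.mul_inv_rev, hUi, hUi', Matrix.mul_assoc]
  have hdet : ∀ A, (gram (R A)).det = (gram A).det := by
    intro A
    have h1 : U.det * U.transpose.det = 1 := by rw [← Matrix.det_mul, hUU', Matrix.det_one]
    rw [hgram, Matrix.det_mul, Matrix.det_mul]
    linear_combination (gram A).det * h1
  have hUw : U.transpose.mulVec w = Pi.single i₀ ‖V‖ := by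
    have h1 : w = ‖V‖ • (b i₀).ofLp := by
      rw [hb0, WithLp.ofLp_smul, smul_smul, mul_inv_cancel₀ hV0.ne', one_smul]
    ext k
    have h2 : U.transpose.mulVec w k = (b k).ofLp ⬝ᵥ w := rfl
    rw [h2, h1, dotProduct_smul, orthonormalBasis_dotProduct]
    by_cases hk : k = i₀
    · subst hk; simp
    · simp [hk]
  have hquad : ∀ A, w ⬝ᵥ (gram (R A))⁻¹.mulVec w = (w ⬝ᵥ w) * (gram A)⁻¹ i₀ i₀ := by
    intro A
    rw [hinv, ← Matrix.mulVec_mulVec, ← Matrix.mulVec_mulVec, hUw, Matrix.dotProduct_mulVec,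
      ← Matrix.mulVec_transpose, hUw, ← hVn]
    simp
    ring
  rw [← hR.measure_preimage]
  · congr 1
    ext A
    simp only [Set.mem_preimage, Set.mem_ofPred_eq, hdet, hquad]
  · refine MeasurableSet.nullMeasurableSet (measurableSet_gram_det_ne_zero.inter ?_)
    exact measurableSet_le (measurable_gram_quadForm.comp (measurable_id.prodMk measurable_const))
      measurable_const

/-- The form is compared with `‖w‖²` divided by the squared residual of one row, in dimension `m = d
- n + 1`. The two factors come from the Laplace transform of `‖w‖²` and the exponential moment of
that residual; `u` is free for optimization. -/
theorem gaussian_measure_quadForm_le {n d m : ℕ} (hn : 0 < n) (hm : m + n = d + 1) {u τ : ℝ}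
    (hu : 0 < u) (hτ : 0 < τ) (huτ : u * τ < 1) :
    ((Measure.pi fun _ : Fin n => stdGaussianPi (Fin d)).prod (stdGaussianPi (Fin n)))
        {ω | (gram ω.1).det ≠ 0 ∧ ω.2 ⬝ᵥ (gram ω.1)⁻¹.mulVec ω.2 ≤ τ} ≤
      ENNReal.ofReal (√((1 + u) ^ n)⁻¹ * √((1 - u * τ) ^ m)⁻¹) := by
  set ν := Measure.pi fun _ : Fin n => stdGaussianPi (Fin d) with hν
  let i₀ : Fin n := ⟨0, hn⟩
  have hms : MeasurableSet {ω : (Fin n → Fin d → ℝ) × (Fin n → ℝ) |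
      (gram ω.1).det ≠ 0 ∧ ω.2 ⬝ᵥ (gram ω.1)⁻¹.mulVec ω.2 ≤ τ} :=
    (measurable_fst measurableSet_gram_det_ne_zero).inter
      (measurableSet_le measurable_gram_quadForm measurable_const)
  rw [Measure.prod_apply_symm hms]
  set f : (Fin n → Fin d → ℝ) → ENNReal := {A | (gram A).det ≠ 0}.indicator fun A =>
    ENNReal.ofReal (Real.exp (u * τ / 2 * ((gram A)⁻¹ i₀ i₀)⁻¹)) with hf
  have hfm : Measurable f := by
    refine Measurable.indicator ?_ measurableSet_gram_det_ne_zero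
    exact (((measurable_gram_inv_apply i₀ i₀).inv.const_mul _).exp).ennreal_ofReal
  have hfint : ∫⁻ A, f A ∂ν ≤ ENNReal.ofReal (√((1 - u * τ) ^ m)⁻¹) := by
    have h := lintegral_le_of_dominatesResidual (μ := stdGaussianPi (Fin d)) {i₀} hfm
      (s := u * τ / 2) (C := ENNReal.ofReal (√((1 - u * τ) ^ m)⁻¹)) ?_ ?_ ?_
    · simpa using h
    · intro r b hb hr
      obtain rfl : r = m := by rw [Finset.card_singleton] at hr; omega
      exact (lintegral_exp_sum_sq_orthonormal hb (by positivity) huτ).le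
    · intro A hA
      exact Set.indicator_of_notMem (by simpa using hA) _
    · intro A hA ρ hρ
      rw [hf, Set.indicator_of_mem (by exact hA)]
      refine ENNReal.ofReal_le_ofReal (Real.exp_le_exp.2 ?_)
      rw [Finset.sum_singleton]
      refine mul_le_mul_of_nonneg_left ?_ (by positivity)
      have h1 := one_le_mul_inv_gram_diag (A := Matrix.of A) hA
        (hρ i₀ (Finset.mem_singleton_self _))
      have h2 : 0 < (gram A)⁻¹ i₀ i₀ := (gram_posDef (A := Matrix.of A) hA).inv.diag_pos
      rw [inv_le_iff_one_le_mul₀ h2]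
      exact h1
  have hslice : ∀ w : Fin n → ℝ, ν ((fun A => (A, w)) ⁻¹' {ω : (Fin n → Fin d → ℝ) × (Fin n → ℝ) |
      (gram ω.1).det ≠ 0 ∧ ω.2 ⬝ᵥ (gram ω.1)⁻¹.mulVec ω.2 ≤ τ}) ≤
      ENNReal.ofReal (Real.exp (-(u * (w ⬝ᵥ w)) / 2)) * ∫⁻ A, f A ∂ν := by
    intro w
    refine (gaussian_measure_quadForm_le_eq i₀ w τ).le.trans ?_
    rw [← lintegral_const_mul _ hfm]
    refine meas_le_lintegral₀ (hfm.const_mul _).aemeasurable ?_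
    rintro A ⟨hA, hq⟩
    have h2 : 0 < (gram A)⁻¹ i₀ i₀ := (gram_posDef (A := Matrix.of A) hA).inv.diag_pos
    rw [hf, Set.indicator_of_mem (by exact hA), ← ENNReal.ofReal_mul (Real.exp_pos _).le,
      ← Real.exp_add, ENNReal.one_le_ofReal]
    refine Real.one_le_exp ?_
    have h3 : w ⬝ᵥ w ≤ τ * ((gram A)⁻¹ i₀ i₀)⁻¹ := by
      rwa [← div_eq_mul_inv, le_div_iff₀ h2]
    have h4 := mul_le_mul_of_nonneg_left h3 hu.le
    linarith
  refine (lintegral_mono hslice).trans ?_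
  rw [lintegral_mul_const _ (by simp only [dotProduct]; fun_prop),
    lintegral_exp_neg_mul_dotProduct_self (by positivity), ENNReal.ofReal_mul (Real.sqrt_nonneg _)]
  exact mul_le_mul_right hfint _

/-- By convexity it suffices to compare at the endpoints, where the rational bounds on the
exponential used here give equality. -/
theorem two_mul_exp_le {x : ℝ} (h1 : 1 / 4 ≤ x) (h2 : x ≤ 2.2) :
    2 * Real.exp x ≤ 8 * x + 1 := by
  have e1 : Real.exp (1 / 4) ≤ 3 / 2 := by
    have := Real.abs_exp_sub_one_sub_id_le (x := 1 / 4) (by norm_num [abs_of_pos])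
    have := (abs_le.1 this).2
    norm_num at this ⊢
    linarith
  have e2 : Real.exp 2.2 ≤ 9.3 := by
    have h3 := Real.abs_exp_sub_one_sub_id_le (x := 1 / 5) (by norm_num [abs_of_pos])
    have h4 := (abs_le.1 h3).2
    have h5 : Real.exp 1 ≤ 2.7183 := Real.exp_one_lt_d9.le.trans (by norm_num)
    have h6 : Real.exp 2.2 = Real.exp 1 ^ 2 * Real.exp (1 / 5) := by
      rw [← Real.exp_nat_mul, ← Real.exp_add]; norm_num
    have h7 : Real.exp (1 / 5) ≤ 1.24 := by norm_num at h4 ⊢; linarith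
    rw [h6]
    calc Real.exp 1 ^ 2 * Real.exp (1 / 5) ≤ 2.7183 ^ 2 * 1.24 := by gcongr
      _ ≤ 9.3 := by norm_num
  set θ := (x - 1 / 4) / 1.95 with hθ
  have hθ0 : 0 ≤ θ := by rw [hθ]; apply div_nonneg <;> linarith
  have hθ1 : 0 ≤ 1 - θ := by
    rw [hθ, sub_nonneg, div_le_one (by norm_num)]; norm_num; linarith
  have h := convexOn_exp.2 (Set.mem_univ (1 / 4 : ℝ)) (Set.mem_univ (2.2 : ℝ)) hθ1 hθ0 (by ring)
  have hx : (1 - θ) • (1 / 4 : ℝ) + θ • (2.2 : ℝ) = x := by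
    simp only [smul_eq_mul]
    rw [hθ]; ring
  rw [hx] at h
  simp only [smul_eq_mul] at h
  have hxθ : x = 1 / 4 + 1.95 * θ := by rw [hθ]; ring
  nlinarith [mul_le_mul_of_nonneg_left e1 hθ1, mul_le_mul_of_nonneg_left e2 hθ0]

theorem gaussian_measure_quadForm_le_exp {n d : ℕ} (hn : 1 ≤ n) (hnd : n < d)
    (hL : Real.log ((d : ℝ) / n) ≤ 2.2) {δ : ℝ} (hδ : 0 < δ) (hδ1 : δ < 1) :
    ((Measure.pi fun _ : Fin n => stdGaussianPi (Fin d)).prod (stdGaussianPi (Fin n)))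
        {ω | (gram ω.1).det ≠ 0 ∧ ω.2 ⬝ᵥ (gram ω.1)⁻¹.mulVec ω.2 ≤
          (1 - δ) / (16 * Real.log ((d : ℝ) / n))} ≤
      ENNReal.ofReal (Real.exp (-(n * Real.log ((d : ℝ) / n))) +
        Real.exp (-(n * δ ^ 2 / 2))) := by
  have hn0 : (0 : ℝ) < n := by exact_mod_cast hn
  have hd0 : (0 : ℝ) < d := by exact_mod_cast (by omega : 0 < d)
  have hL0 : 0 < Real.log ((d : ℝ) / n) :=
    Real.log_pos (by rw [lt_div_iff₀ hn0, one_mul]; exact_mod_cast hnd)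
  have hexpL : Real.exp (Real.log ((d : ℝ) / n)) = d / n := Real.exp_log (by positivity)
  set L := Real.log ((d : ℝ) / n) with hLdef
  obtain ⟨m, hm⟩ : ∃ m, m + n = d + 1 := ⟨d + 1 - n, by omega⟩
  have hm2 : (m : ℝ) ≤ n * (2 * (Real.exp L - 1)) := by
    -- The extra one in `m = d - n + 1` is absorbed using `d - n ≥ 1`.
    have h1 : (m : ℝ) ≤ 2 * (d - n) := by
      have h2 : m + 2 * n ≤ 2 * d := by omega
      have h3 : (m : ℝ) + 2 * n ≤ 2 * d := by exact_mod_cast h2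
      linarith
    rw [hexpL]
    refine h1.trans (le_of_eq ?_)
    field_simp
  have h1δ : 0 < 1 - δ := by linarith
  have hτ : 0 < (1 - δ) / (16 * L) := by positivity
  rcases le_or_gt L (1 / 4) with hL4 | hL4
  -- Near `d = n` the term `exp (-n L)` is the target. With `u = 4 L` the exponent is at most
  -- `-(2.77 / 2 - 3 / 8) n L`, barely below `-n L`.
  · have huτ : 4 * L * ((1 - δ) / (16 * L)) = (1 - δ) / 4 := by field_simp; norm_num
    refine (gaussian_measure_quadForm_le hn hm (u := 4 * L) (by positivity) hτ
      (by rw [huτ]; linarith)).trans (ENNReal.ofReal_le_ofReal ?_)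
    rw [huτ, sqrt_inv_pow_eq_exp (by positivity), sqrt_inv_pow_eq_exp (by linarith),
      ← Real.exp_add]
    refine le_trans (Real.exp_le_exp.2 ?_) (le_add_of_nonneg_right (Real.exp_pos _).le)
    have h1 : 4 * L * Real.log 2 ≤ Real.log (1 + 4 * L) := by
      rw [Real.le_log_iff_exp_le (by positivity)]
      have := exp_mul_le_of_convex (p := 4 * L) (z := Real.log 2) (by positivity) (by linarith)
      rw [Real.exp_log two_pos] at this
      linarith
    have h2 : -(3 / 10) ≤ Real.log (1 - (1 - δ) / 4) := by
      rw [Real.le_log_iff_exp_le (by linarith)]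
      have h3 := Real.quadratic_le_exp_of_nonneg (show (0 : ℝ) ≤ 3 / 10 by norm_num)
      rw [Real.exp_neg]
      calc (Real.exp (3 / 10))⁻¹ ≤ (4 / 3 : ℝ)⁻¹ := inv_anti₀ (by norm_num) (by linarith)
        _ ≤ _ := by linarith
    have h3 : Real.exp L - 1 ≤ 5 / 4 * L := by
      have := Real.abs_exp_sub_one_sub_id_le (x := L) (by rw [abs_of_pos hL0]; linarith)
      have := (abs_le.1 this).2
      nlinarith
    have h4 := Real.log_two_gt_d9
    have h5 : (m : ℝ) * Real.log (1 - (1 - δ) / 4) ≥ -(n * (2 * (5 / 4 * L)) * (3 / 10)) := by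
      have h6 : (m : ℝ) ≤ n * (2 * (5 / 4 * L)) :=
        hm2.trans (mul_le_mul_of_nonneg_left (by linarith) hn0.le)
      have h7 : (0 : ℝ) ≤ m := Nat.cast_nonneg m
      nlinarith
    have h6 : (n : ℝ) * Real.log (1 + 4 * L) ≥ n * (4 * L * (27 / 40)) + n * (L * (7 / 100)) := by
      rw [← mul_add]
      refine mul_le_mul_of_nonneg_left (le_trans ?_ h1) hn0.le
      nlinarith
    have h7 : 0 < n * L := by positivity
    nlinarith
  -- Here the target is `exp (-n δ² / 2)`. With `u = 2`, `log 3 ≥ 1` and `m ≤ n (8 L - 1)`, the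
  -- exponent is at most `-n / 2 + n (1 - δ) / 2 = -n δ / 2`.
  · have huτ : 2 * ((1 - δ) / (16 * L)) = (1 - δ) / (8 * L) := by field_simp; norm_num
    have h8L : 0 < 8 * L - 1 := by linarith
    have hlt : (1 - δ) / (8 * L) < 1 := by rw [div_lt_one (by positivity)]; linarith
    refine (gaussian_measure_quadForm_le hn hm (u := 2) (by norm_num) hτ
      (by rwa [huτ])).trans (ENNReal.ofReal_le_ofReal ?_)
    rw [huτ, sqrt_inv_pow_eq_exp (by norm_num), sqrt_inv_pow_eq_exp (by linarith),
      ← Real.exp_add]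
    refine le_trans (Real.exp_le_exp.2 ?_) (le_add_of_nonneg_left (Real.exp_pos _).le)
    have h1 : (1 : ℝ) ≤ Real.log (1 + 2) := by
      rw [Real.le_log_iff_exp_le (by norm_num)]
      exact Real.exp_one_lt_d9.le.trans (by norm_num)
    have h2 : -((1 - δ) / (8 * L - 1)) ≤ Real.log (1 - (1 - δ) / (8 * L)) := by
      refine le_trans ?_ (Real.one_sub_inv_le_log_of_pos (by linarith))
      have h3 : 1 - (1 - (1 - δ) / (8 * L))⁻¹ = -((1 - δ) / (8 * L - (1 - δ))) := by
        have : 8 * L - (1 - δ) ≠ 0 := by linarith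
        rw [show 1 - (1 - δ) / (8 * L) = (8 * L - (1 - δ)) / (8 * L) by field_simp, inv_div]
        field_simp
        ring
      rw [h3, neg_le_neg_iff]
      exact div_le_div_of_nonneg_left h1δ.le h8L (by linarith)
    have h3 : (m : ℝ) ≤ n * (8 * L - 1) :=
      hm2.trans (mul_le_mul_of_nonneg_left (by linarith [two_mul_exp_le hL4.le hL]) hn0.le)
    have h4 : -(n * (1 - δ)) ≤ (m : ℝ) * Real.log (1 - (1 - δ) / (8 * L)) := by
      have h5 : (m : ℝ) * ((1 - δ) / (8 * L - 1)) ≤ n * (1 - δ) := by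
        refine (mul_le_mul_of_nonneg_right h3 (by positivity)).trans (le_of_eq ?_)
        field_simp
      have h6 := mul_le_mul_of_nonneg_left h2 (Nat.cast_nonneg (α := ℝ) m)
      linarith
    have h5 := mul_le_mul_of_nonneg_left h1 hn0.le
    have h6 : (n : ℝ) * δ ^ 2 ≤ n * δ := mul_le_mul_of_nonneg_left (by nlinarith) hn0.le
    generalize Real.log (1 + 2) = y at *
    generalize (m : ℝ) * Real.log (1 - (1 - δ) / (8 * L)) = z at *
    nlinarith

/-! ### The test error and the standardized training data -/

theorem integrable_mul_gaussianFeature {d : ℕ} (j l : Fin d) :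
    Integrable (fun x : Fin d → ℝ => x j * x l) (stdGaussianPi (Fin d)) ∧
      ∫ x, x j * x l ∂(stdGaussianPi (Fin d)) = if j = l then 1 else 0 := by
  have hp : ∀ i, MeasurePreserving (fun x : Fin d → ℝ => x i) (stdGaussianPi (Fin d))
      (gaussianReal 0 1) := fun i => measurePreserving_eval (fun _ : Fin d => gaussianReal 0 1) i
  have hL2 : ∀ i, MemLp (fun x : Fin d → ℝ => x i) 2 (stdGaussianPi (Fin d)) := fun i =>
    (memLp_id_gaussianReal 2).comp_measurePreserving (hp i)
  refine ⟨(hL2 j).integrable_mul (hL2 l), ?_⟩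
  have hmean : ∀ i, ∫ x : Fin d → ℝ, x i ∂(stdGaussianPi (Fin d)) = 0 := by
    intro i
    have := (hp i).map_eq
    rw [← integral_map (φ := fun x : Fin d → ℝ => x i) (f := fun y => y)
      (measurable_pi_apply i).aemeasurable measurable_id.aestronglyMeasurable, this,
      integral_id_gaussianReal]
  split_ifs with hjl
  · subst hjl
    have := (hp j).map_eq
    rw [← integral_map (φ := fun x : Fin d → ℝ => x j) (f := fun y => y * y)
      (measurable_pi_apply j).aemeasurable (by fun_prop), this]
    have hv := variance_id_gaussianReal (μ := 0) (v := 1)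
    rw [variance_of_integral_eq_zero measurable_id.aemeasurable
      (by simp [integral_id_gaussianReal])] at hv
    simpa [sq] using hv
  · have hind := (iIndepFun_pi (μ := fun _ : Fin d => gaussianReal 0 1)
      (X := fun _ (y : ℝ) => y) fun _ => measurable_id.aemeasurable).indepFun hjl
    have := hind.integral_fun_mul_eq_mul_integral
      (measurable_pi_apply j).aestronglyMeasurable (measurable_pi_apply l).aestronglyMeasurable
    rw [this, hmean, zero_mul]

theorem IsGaussianFeature.isWhitened {p d : ℕ} {P : Measure (Fin p → ℝ)}
    {a : (Fin p → ℝ) → (Fin d → ℝ)} (ha : Measurable a) (h : IsGaussianFeature P a) :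
    IsWhitened P a := by
  intro j l
  have h1 := integrable_mul_gaussianFeature (d := d) j l
  rw [stdGaussianPi, ← h, integrable_map_measure (by fun_prop) ha.aemeasurable,
    integral_map ha.aemeasurable (by fun_prop)] at h1
  exact h1

/-- The cross term vanishes because the fresh noise is centred and independent, and whitening turns
the second moment of the prediction into `α ⬝ᵥ α`. -/
theorem testMSE_zero {p d : ℕ} {P : Measure (Fin p → ℝ)} [IsProbabilityMeasure P]
    {a : (Fin p → ℝ) → (Fin d → ℝ)} (ha : Measurable a) (h : IsWhitened P a) (σ : ℝ)
    (α : Fin d → ℝ) : testMSE P a 0 σ α = α ⬝ᵥ α := by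
  set z : (Fin p → ℝ) → ℝ := fun x => a x ⬝ᵥ α with hz
  have hzm : Measurable z := by simp only [hz, dotProduct]; fun_prop
  have hsq : ∀ x, z x ^ 2 = ∑ j, ∑ l, (α j * α l) * (a x j * a x l) := by
    intro x
    simp only [hz, dotProduct, sq, Finset.sum_mul_sum]
    exact Finset.sum_congr rfl fun j _ => Finset.sum_congr rfl fun l _ => by ring
  have hzi2 : Integrable (fun x => z x ^ 2) P := by
    simp only [hsq]
    exact integrable_finsetSum _ fun j _ => integrable_finsetSum _ fun l _ =>
      (h j l).1.const_mul _
  have hzint : ∫ x, z x ^ 2 ∂P = α ⬝ᵥ α := by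
    simp only [hsq]
    rw [integral_finsetSum _ fun j _ => integrable_finsetSum _ fun l _ => (h j l).1.const_mul _]
    simp_rw [integral_finsetSum _ fun l _ => (h _ l).1.const_mul _, integral_const_mul, (h _ _).2]
    simp [dotProduct]
  have hzi : Integrable z P := by
    have : MemLp z 2 P := (memLp_two_iff_integrable_sq hzm.aestronglyMeasurable).2 hzi2
    exact this.integrable one_le_two
  have hw2 : MemLp (fun w : ℝ => w) 2 (noiseLaw σ) := memLp_id_gaussianReal 2
  have : IsProbabilityMeasure (noiseLaw σ) := by unfold noiseLaw; infer_instance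
  have hwi : Integrable (fun w : ℝ => w) (noiseLaw σ) := hw2.integrable one_le_two
  have hwmean : ∫ w, w ∂(noiseLaw σ) = 0 := integral_id_gaussianReal
  have hwvar : ∫ w, w ^ 2 ∂(noiseLaw σ) = σ ^ 2 := by
    have hv := variance_id_gaussianReal (μ := 0) (v := Real.toNNReal (σ ^ 2))
    rw [variance_of_integral_eq_zero measurable_id.aemeasurable
      (by simp [integral_id_gaussianReal])] at hv
    simpa [noiseLaw, Real.coe_toNNReal _ (sq_nonneg σ)] using hv
  unfold testMSE
  have hexp : ∀ q : (Fin p → ℝ) × ℝ, ((a q.1 ⬝ᵥ (0 : Fin d → ℝ) + q.2) - a q.1 ⬝ᵥ α) ^ 2 =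
      z q.1 ^ 2 - 2 * (z q.1 * q.2) + q.2 ^ 2 := by
    intro q
    rw [dotProduct_zero]
    simp only [hz]
    ring
  simp only [hexp]
  have i1 : Integrable (fun q : (Fin p → ℝ) × ℝ => z q.1 ^ 2) (P.prod (noiseLaw σ)) :=
    hzi2.comp_fst _
  have i2 : Integrable (fun q : (Fin p → ℝ) × ℝ => 2 * (z q.1 * q.2)) (P.prod (noiseLaw σ)) :=
    (hzi.mul_prod hwi).const_mul 2
  have i3 : Integrable (fun q : (Fin p → ℝ) × ℝ => q.2 ^ 2) (P.prod (noiseLaw σ)) :=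
    hw2.integrable_sq.comp_snd _
  rw [integral_add (f := fun q : (Fin p → ℝ) × ℝ => z q.1 ^ 2 - 2 * (z q.1 * q.2)) (i1.sub i2) i3,
    integral_sub i1 i2, integral_const_mul,
    integral_prod_mul (fun x => z x) (fun w : ℝ => w), hwmean,
    integral_fun_fst (fun x => z x ^ 2), integral_fun_snd (fun w : ℝ => w ^ 2), hzint, hwvar]
  simp

theorem measurePreserving_standardize {p d n : ℕ} {P : Measure (Fin p → ℝ)}
    [IsProbabilityMeasure P] {a : (Fin p → ℝ) → (Fin d → ℝ)} (ha : Measurable a) {σ : ℝ}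
    (hσ : 0 < σ) :
    MeasurePreserving (fun ω : (Fin n → (Fin p → ℝ)) × (Fin n → ℝ) =>
        ((fun i => a (ω.1 i) : Fin n → Fin d → ℝ), (fun i => σ⁻¹ * ω.2 i : Fin n → ℝ)))
      (trainLaw P σ n)
      ((Measure.pi fun _ : Fin n => P.map a).prod (stdGaussianPi (Fin n))) := by
  have : IsProbabilityMeasure (noiseLaw σ) := by unfold noiseLaw; infer_instance
  have : IsProbabilityMeasure (P.map a) := Measure.isProbabilityMeasure_map ha.aemeasurable
  have h1 : MeasurePreserving (fun (X : Fin n → (Fin p → ℝ)) i => a (X i))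
      (Measure.pi fun _ : Fin n => P) (Measure.pi fun _ : Fin n => P.map a) :=
    measurePreserving_pi _ _ fun _ => ⟨ha, rfl⟩
  have h2 : MeasurePreserving (fun w : ℝ => σ⁻¹ * w) (noiseLaw σ) (gaussianReal 0 1) := by
    refine ⟨by fun_prop, ?_⟩
    rw [noiseLaw, gaussianReal_map_const_mul, mul_zero]
    congr 1
    ext
    simp only [NNReal.coe_mul, NNReal.coe_mk, Real.coe_toNNReal _ (sq_nonneg σ), NNReal.coe_one]
    field_simp
  exact h1.prod (measurePreserving_pi _ _ fun _ => h2)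

/-- Reduction to an estimate for the standardized training data `(A, w)`. -/
theorem fitsNoiseHarmfully_of_measure_le {p n d : ℕ} {P : Measure (Fin p → ℝ)}
    [IsProbabilityMeasure P] {a : (Fin p → ℝ) → (Fin d → ℝ)} (ha : Measurable a)
    (hw : IsWhitened P a) {σ β C : ℝ} (hσ : 0 < σ) (hβ : 0 < β)
    (hCL : 0 < C * Real.log ((d : ℝ) / n))
    {alg : Matrix (Fin n) (Fin d) ℝ → (Fin n → ℝ) → (Fin d → ℝ)}
    (halg : ∀ᵐ X ∂(Measure.pi fun _ : Fin n => P),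
      IsParsimonious β (dataMatrix a X) (alg (dataMatrix a X)))
    (h : ∀ δ : ℝ, 0 < δ → δ < 1 → ∃ B : Set ((Fin n → Fin d → ℝ) × (Fin n → ℝ)),
      ((Measure.pi fun _ : Fin n => P.map a).prod (stdGaussianPi (Fin n))) B ≤
        ENNReal.ofReal (Real.exp (-(n * Real.log ((d : ℝ) / n))) +
          Real.exp (-(n * δ ^ 2 / 2))) ∧
      ∀ (A : Fin n → Fin d → ℝ) (w : Fin n → ℝ) (α : Fin d → ℝ) (S : Finset (Fin d)),
        (gram A).det ≠ 0 → (Matrix.of A).mulVec α = w → S.card = n →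
        β * (w ⬝ᵥ w) ≤ ∑ i, (A i ⬝ᵥ truncTo S α) ^ 2 →
        α ⬝ᵥ α < β * ((1 - δ) / (C * Real.log ((d : ℝ) / n))) → (A, w) ∈ B) :
    FitsNoiseHarmfully P a σ β C alg := by
  intro k
  refine ⟨0, by simp [IsSparse], fun δ hδ => ?_⟩
  simp only [testMSE_zero ha hw]
  have hαα : ∀ α : Fin d → ℝ, 0 ≤ α ⬝ᵥ α := fun α => by
    simpa [dotProduct, ← sq] using Finset.sum_nonneg fun j _ => sq_nonneg (α j)
  -- For `δ ≥ 1` the claimed lower bound is nonpositive, so the bad event is empty.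
  rcases le_or_gt 1 δ with hδ1 | hδ1
  · have : {ω : (Fin n → (Fin p → ℝ)) × (Fin n → ℝ) |
        ¬ (β * σ ^ 2 * (1 - δ) / (C * Real.log ((d : ℝ) / n)) ≤
          alg (dataMatrix a ω.1) (trainOutput a 0 ω) ⬝ᵥ
            alg (dataMatrix a ω.1) (trainOutput a 0 ω))} = ∅ := by
      refine Set.eq_empty_iff_forall_notMem.2 fun ω hω => hω ?_
      refine le_trans (div_nonpos_of_nonpos_of_nonneg ?_ hCL.le) (hαα _)
      exact mul_nonpos_of_nonneg_of_nonpos (by positivity) (by linarith)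
    rw [this, measure_empty]
    exact zero_le
  obtain ⟨B, hB, hmem⟩ := h δ hδ hδ1
  have hmp := measurePreserving_standardize (n := n) ha hσ (P := P)
  refine le_trans ?_ hB
  rw [← hmp.map_eq]
  -- This inequality for the image measure holds for arbitrary sets, so measurability of neither
  -- `alg` nor `B` is required.
  refine le_trans (measure_mono_ae ?_) (Measure.le_map_apply hmp.measurable.aemeasurable B)
  have hae : ∀ᵐ ω ∂(trainLaw P σ n),
      IsParsimonious β (dataMatrix a ω.1) (alg (dataMatrix a ω.1)) :=
    Measure.quasiMeasurePreserving_fst.ae halg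
  filter_upwards [hae] with ω hω hbad
  change ¬ _ at hbad
  push Not at hbad
  have hY : trainOutput a 0 ω = ω.2 := by simp [trainOutput]
  rw [hY] at hbad
  set α := alg (dataMatrix a ω.1) ω.2 with hα
  obtain ⟨hint, S, hS, hβS⟩ := hω ω.2
  rw [← hα] at hint hS hβS
  refine hmem (fun i => a (ω.1 i)) (fun i => σ⁻¹ * ω.2 i) (σ⁻¹ • α) S ?_ ?_ hS.1 ?_ ?_
  · exact gram_det_ne_zero_of_surjective fun w => ⟨_, (hω w).1⟩
  · have : Matrix.of (fun i => a (ω.1 i)) = dataMatrix a ω.1 := rfl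
    rw [this, Matrix.mulVec_smul, hint]
    rfl
  · have h1 : (fun i => σ⁻¹ * ω.2 i) ⬝ᵥ (fun i => σ⁻¹ * ω.2 i) = (σ⁻¹) ^ 2 * sqNorm ω.2 := by
      simp only [dotProduct, sqNorm, Finset.mul_sum]
      exact Finset.sum_congr rfl fun i _ => by ring
    have h2 : truncTo S (σ⁻¹ • α) = σ⁻¹ • truncTo S α := by
      ext j; simp [truncTo]
    have h3 : ∑ i, (a (ω.1 i) ⬝ᵥ truncTo S (σ⁻¹ • α)) ^ 2 =
        (σ⁻¹) ^ 2 * sqNorm ((dataMatrix a ω.1).mulVec (truncTo S α)) := by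
      rw [h2, sqNorm, Finset.mul_sum]
      refine Finset.sum_congr rfl fun i _ => ?_
      rw [dotProduct_smul, smul_eq_mul, mul_pow]
      rfl
    rw [h1, h3]
    have := mul_le_mul_of_nonneg_left hβS (sq_nonneg σ⁻¹)
    linarith
  · rw [smul_dotProduct, dotProduct_smul, smul_eq_mul, smul_eq_mul]
    have h1 : β * ((1 - δ) / (C * Real.log ((d : ℝ) / n))) =
        σ⁻¹ * (σ⁻¹ * (β * σ ^ 2 * (1 - δ) / (C * Real.log ((d : ℝ) / n)))) := by
      field_simp
    rw [h1]
    have hσi : 0 < σ⁻¹ := inv_pos.2 hσ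
    exact mul_lt_mul_of_pos_left (mul_lt_mul_of_pos_left hbad hσi) hσi

/-! ### The regimes of large and small `d / n` -/

theorem log_div_pos {n d : ℕ} (hn : 1 ≤ n) (hnd : n < d) : 0 < Real.log ((d : ℝ) / n) := by
  have hn0 : (0 : ℝ) < n := by exact_mod_cast hn
  exact Real.log_pos (by rw [lt_div_iff₀ hn0, one_mul]; exact_mod_cast hnd)

/-- The case of large `d / n`, where parsimony is used. -/
theorem fitsNoiseHarmfully_of_hasExpSqMoments {p n d : ℕ} (hn : 1 ≤ n) (hnd : n < d)
    {P : Measure (Fin p → ℝ)} [IsProbabilityMeasure P] {a : (Fin p → ℝ) → (Fin d → ℝ)}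
    (ha : Measurable a) (hw : IsWhitened P a) {σ β C s c ε : ℝ} (hσ : 0 < σ) (hβ : 0 < β)
    (hCpos : 0 < C) {alg : Matrix (Fin n) (Fin d) ℝ → (Fin n → ℝ) → (Fin d → ℝ)}
    (halg : ∀ᵐ X ∂(Measure.pi fun _ : Fin n => P),
      IsParsimonious β (dataMatrix a X) (alg (dataMatrix a X)))
    (hμ : HasExpSqMoments (P.map a) s c) (hs : 0 < s) (hc : 0 ≤ c) (hε : 0 < ε) (hε' : ε < 1 / 2)
    (hC : Real.log ((d : ℝ) / n) + 1 + c - Real.log ε ≤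
      3 / 4 * (C * Real.log ((d : ℝ) / n) * (s * (1 - 2 * ε) ^ 2))) :
    FitsNoiseHarmfully P a σ β C alg := by
  have : IsProbabilityMeasure (P.map a) := Measure.isProbabilityMeasure_map ha.aemeasurable
  have hL := log_div_pos hn hnd
  have hCL : 0 < C * Real.log ((d : ℝ) / n) := mul_pos hCpos hL
  refine fitsNoiseHarmfully_of_measure_le ha hw hσ hβ hCL halg fun δ hδ hδ1 => ⟨_,
    (measure_exists_sparse_le hn hnd hμ hs hc hε hε' hδ hδ1 hC).trans
      (ENNReal.ofReal_le_ofReal (le_add_of_nonneg_left (Real.exp_pos _).le)), ?_⟩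
  intro A w α S _ _ hS hβS hα
  set τ := β * ((1 - δ) / (C * Real.log ((d : ℝ) / n))) with hτ
  have hτ0 : 0 < τ := mul_pos hβ (div_pos (by linarith) hCL)
  have htr : truncTo S α ⬝ᵥ truncTo S α ≤ α ⬝ᵥ α := by
    refine Finset.sum_le_sum fun j _ => ?_
    simp only [truncTo]
    split_ifs
    · exact le_rfl
    · simpa using mul_self_nonneg (α j)
  -- Dividing by `√τ` puts the truncation in the unit ball; the factor `β` in `τ` cancels the one in
  -- the parsimony inequality.
  refine ⟨S, hS, (√τ)⁻¹ • truncTo S α, fun j hj => by simp [truncTo, hj], ?_, ?_⟩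
  · rw [smul_dotProduct, dotProduct_smul, smul_eq_mul, smul_eq_mul, ← mul_assoc, ← mul_inv,
      Real.mul_self_sqrt hτ0.le, inv_mul_le_iff₀ hτ0, mul_one]
    exact htr.trans hα.le
  · simp only [dotProduct_smul, smul_eq_mul, mul_pow, inv_pow, Real.sq_sqrt hτ0.le]
    rw [← Finset.mul_sum]
    have h1 := mul_le_mul_of_nonneg_left hβS (inv_nonneg.2 hτ0.le)
    refine le_trans (le_of_eq ?_) h1
    have : 1 - δ ≠ 0 := by linarith
    rw [hτ]
    field_simp

/-- The case of small `d / n`, where only interpolation is used. -/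
theorem fitsNoiseHarmfully_of_quadForm {p n d : ℕ} (hn : 1 ≤ n) (hnd : n < d)
    {P : Measure (Fin p → ℝ)} [IsProbabilityMeasure P] {a : (Fin p → ℝ) → (Fin d → ℝ)}
    (ha : Measurable a) (hw : IsWhitened P a) {σ β C : ℝ} (hσ : 0 < σ) (hβ : 0 < β) (hβ1 : β ≤ 1)
    (hCpos : 0 < C) {alg : Matrix (Fin n) (Fin d) ℝ → (Fin n → ℝ) → (Fin d → ℝ)}
    (halg : ∀ᵐ X ∂(Measure.pi fun _ : Fin n => P),
      IsParsimonious β (dataMatrix a X) (alg (dataMatrix a X)))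
    (h : ∀ δ : ℝ, 0 < δ → δ < 1 →
      ((Measure.pi fun _ : Fin n => P.map a).prod (stdGaussianPi (Fin n)))
        {ω | (gram ω.1).det ≠ 0 ∧ ω.2 ⬝ᵥ (gram ω.1)⁻¹.mulVec ω.2 ≤
          (1 - δ) / (C * Real.log ((d : ℝ) / n))} ≤
        ENNReal.ofReal (Real.exp (-(n * Real.log ((d : ℝ) / n))) +
          Real.exp (-(n * δ ^ 2 / 2)))) :
    FitsNoiseHarmfully P a σ β C alg := by
  have hCL : 0 < C * Real.log ((d : ℝ) / n) := mul_pos hCpos (log_div_pos hn hnd)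
  refine fitsNoiseHarmfully_of_measure_le ha hw hσ hβ hCL halg fun δ hδ hδ1 =>
    ⟨_, h δ hδ hδ1, ?_⟩
  intro A w α S hA hAα _ _ hα
  refine ⟨hA, (quadForm_le_of_mulVec_eq (A := Matrix.of A) hA hAα).trans (hα.le.trans ?_)⟩
  exact mul_le_of_le_one_left (div_nonneg (by linarith) hCL.le) hβ1

/-! ### Choice of constants and assembly -/

theorem theorem2 :
    -- Gaussian features, all overparameterized dimensions, and the sharper constant for large d / n
    (∃ γ₀ : ℝ, 1 < γ₀ ∧
      ∀ (p n d : ℕ), 1 ≤ n → n < d →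
      ∀ (P : Measure (Fin p → ℝ)) [IsProbabilityMeasure P]
        (a : (Fin p → ℝ) → (Fin d → ℝ)), Measurable a → IsGaussianFeature P a →
      ∀ (σ β : ℝ), 0 < σ → 0 < β → β ≤ 1 →
      ∀ alg : Matrix (Fin n) (Fin d) ℝ → (Fin n → ℝ) → (Fin d → ℝ),
        (∀ᵐ X ∂(Measure.pi fun _ : Fin n => P),
          IsParsimonious β (dataMatrix a X) (alg (dataMatrix a X))) →
        FitsNoiseHarmfully P a σ β 16 alg ∧
          (γ₀ * n ≤ d → FitsNoiseHarmfully P a σ β 4 alg)) ∧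
    -- whitened features with sub-Gaussian rows
    (∀ K : ℝ, 0 < K → ∃ C : ℝ, 0 < C ∧
      ∀ (p n d : ℕ), 1 ≤ n → n < d →
      ∀ (P : Measure (Fin p → ℝ)) [IsProbabilityMeasure P]
        (a : (Fin p → ℝ) → (Fin d → ℝ)), Measurable a → IsWhitened P a →
        IsSubGaussianFeature P a K →
      ∀ (σ β : ℝ), 0 < σ → 0 < β → β ≤ 1 →
      ∀ alg : Matrix (Fin n) (Fin d) ℝ → (Fin n → ℝ) → (Fin d → ℝ),
        (∀ᵐ X ∂(Measure.pi fun _ : Fin n => P),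
          IsParsimonious β (dataMatrix a X) (alg (dataMatrix a X))) →
        FitsNoiseHarmfully P a σ β C alg) := by
  refine ⟨⟨Real.exp 1000, Real.one_lt_exp_iff.2 (by norm_num), ?_⟩, ?_⟩
  · intro p n d hn hnd P _ a ha hG σ β hσ hβ hβ1 alg halg
    have hw := hG.isWhitened ha
    have hn0 : (0 : ℝ) < n := by exact_mod_cast hn
    refine ⟨?_, fun hγ => ?_⟩
    -- The threshold `2.2` is where both arguments work with constant `16`: it ends the range of
    -- `two_mul_exp_le`, and beyond it `(81 / 28 - 1) L` exceeds the additive costs `1 + log 7 / 2 +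
    -- 3 log 2`.
    · rcases le_or_gt (Real.log ((d : ℝ) / n)) 2.2 with hL | hL
      · refine fitsNoiseHarmfully_of_quadForm hn hnd ha hw hσ hβ hβ1 (by norm_num) halg
          fun δ hδ hδ1 => ?_
        rw [show P.map a = stdGaussianPi (Fin d) from hG]
        exact gaussian_measure_quadForm_le_exp hn hnd hL hδ hδ1
      · have hμ : HasExpSqMoments (P.map a) (3 / 7) (-(Real.log (1 - 2 * (3 / 7))) / 2) := by
          rw [show P.map a = stdGaussianPi (Fin d) from hG]
          exact .gaussian (by norm_num) (by norm_num)
        have e1 : Real.log (1 - 2 * (3 / 7)) = -Real.log 7 := by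
          rw [← Real.log_inv]; norm_num
        have e2 : Real.log (1 / 8) = -(3 * Real.log 2) := by
          rw [one_div, Real.log_inv, show (8 : ℝ) = 2 ^ 3 by norm_num, Real.log_pow]; norm_num
        have h7 : Real.log 7 ≤ 2 := by
          rw [Real.log_le_iff_le_exp (by norm_num), show (2 : ℝ) = (2 : ℕ) * 1 by norm_num,
            Real.exp_nat_mul]
          nlinarith [Real.exp_one_gt_d9]
        have h7' : 0 ≤ Real.log 7 := Real.log_nonneg (by norm_num)
        have h2 := Real.log_two_lt_d9
        refine fitsNoiseHarmfully_of_hasExpSqMoments hn hnd ha hw hσ hβ (by norm_num) halg hμ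
          (by norm_num) (ε := 1 / 8) (by rw [e1]; linarith) (by norm_num) (by norm_num) ?_
        rw [e1, e2]
        norm_num at hL ⊢
        linarith
    · have hL : 1000 ≤ Real.log ((d : ℝ) / n) := by
        rw [Real.le_log_iff_exp_le (div_pos (by exact_mod_cast (by omega : 0 < d)) hn0),
          le_div_iff₀ hn0]
        exact hγ
      -- With constant `4` the coefficient of `L` is `3 * (9 / 20) * (9 / 10)² = 1.0935`, only
      -- slightly above one, so `L` must be large; `1000` is a generous choice.
      have hμ : HasExpSqMoments (P.map a) (9 / 20) (-(Real.log (1 - 2 * (9 / 20))) / 2) := by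
        rw [show P.map a = stdGaussianPi (Fin d) from hG]
        exact .gaussian (by norm_num) (by norm_num)
      have e1 : Real.log (1 - 2 * (9 / 20)) = -Real.log 10 := by
        rw [← Real.log_inv]; norm_num
      have e2 : Real.log (1 / 20) = -Real.log 20 := by rw [one_div, Real.log_inv]
      have h10 := Real.log_le_sub_one_of_pos (show (0 : ℝ) < 10 by norm_num)
      have h20 := Real.log_le_sub_one_of_pos (show (0 : ℝ) < 20 by norm_num)
      have h10' : 0 ≤ Real.log 10 := Real.log_nonneg (by norm_num)
      refine fitsNoiseHarmfully_of_hasExpSqMoments hn hnd ha hw hσ hβ (by norm_num) halg hμ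
        (by norm_num) (ε := 1 / 20) (by rw [e1]; linarith) (by norm_num) (by norm_num) ?_
      rw [e1, e2]
      norm_num at hL ⊢
      linarith
  · intro K hK
    set s := 1 / (4 * Real.exp 1 * K ^ 2) with hs
    have hs0 : 0 < s := by positivity
    set c := Real.log 2 with hc
    have hc0 : 0 < c := Real.log_pos one_lt_two
    have hlog4 : Real.log (1 / 4) = -(2 * c) := by
      rw [one_div, Real.log_inv, show (4 : ℝ) = 2 ^ 2 by norm_num, Real.log_pow, hc]; norm_num
    -- `C₁` is the constant of the regime `d ≤ 2 n`.
    set C₁ := 2 * (Real.exp (2 * c + 4) / s) with hC₁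
    -- `C₂` is tuned, with `ε = 1 / 4`, so that the right side of the sparse condition equals `L + L
    -- (1 + 3 c) / c`.
    set C₂ := 16 / (3 * s) * (1 + (1 + 3 * c) / c) with hC₂
    have hC₁0 : 0 < C₁ := by positivity
    refine ⟨max C₁ C₂, lt_max_of_lt_left hC₁0, ?_⟩
    intro p n d hn hnd P _ a ha hw hsub σ β hσ hβ hβ1 alg halg
    have : IsProbabilityMeasure (P.map a) := Measure.isProbabilityMeasure_map ha.aemeasurable
    have hμ := HasExpSqMoments.of_isSubGaussianFeature ha hK hsub
    have hCpos : 0 < max C₁ C₂ := lt_max_of_lt_left hC₁0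
    have hL := log_div_pos hn hnd
    have hn0 : (0 : ℝ) < n := by exact_mod_cast hn
    rcases le_or_gt d (2 * n) with hd | hd
    · refine fitsNoiseHarmfully_of_quadForm hn hnd ha hw hσ hβ hβ1 hCpos halg fun δ hδ hδ1 => ?_
      refine (measure_mono ?_).trans ((measure_quadForm_le_of_hasExpSqMoments hn hnd hd hμ
        hs0).trans (ENNReal.ofReal_le_ofReal (le_add_of_nonneg_right (Real.exp_pos _).le)))
      rintro ω ⟨h1, h2⟩
      refine ⟨h1, h2.trans ?_⟩
      refine div_le_div₀ zero_le_one (by linarith) (mul_pos hC₁0 hL) ?_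
      exact mul_le_mul_of_nonneg_right (le_max_left _ _) hL.le
    · refine fitsNoiseHarmfully_of_hasExpSqMoments hn hnd ha hw hσ hβ hCpos halg hμ hs0 hc0.le
        (ε := 1 / 4) (by norm_num) (by norm_num) ?_
      rw [hlog4]
      set L := Real.log ((d : ℝ) / n) with hLdef
      -- Since `d > 2 n`, `L` is at least `log 2`, the same number as the moment constant `c`; the
      -- additive cost `1 + 3 c` is thus absorbed into a multiple of `L`.
      have hcL : c ≤ L := by
        refine Real.log_le_log two_pos ?_
        rw [le_div_iff₀ hn0]
        exact_mod_cast hd.le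
      have h1 : 3 / 4 * (C₂ * L * (s * (1 - 2 * (1 / 4)) ^ 2)) = L + L * ((1 + 3 * c) / c) := by
        rw [hC₂]; field_simp; ring
      have h2 : 1 + 3 * c ≤ L * ((1 + 3 * c) / c) := by
        rw [mul_div_assoc', le_div_iff₀ hc0, mul_comm L]
        exact mul_le_mul_of_nonneg_left hcL (by positivity)
      have h3 : 3 / 4 * (C₂ * L * (s * (1 - 2 * (1 / 4)) ^ 2)) ≤
          3 / 4 * (max C₁ C₂ * L * (s * (1 - 2 * (1 / 4)) ^ 2)) := by
        gcongr
        exact le_max_right _ _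
      linarith
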